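/- Let $q\ge 0$ and $k\ge 1$ be integers. Let $F$ be the free group on $x_1,\dots,x_q$, with $F_1=F$ and $F_k=[F_{k-1},F]$. For $R=\mathbb{Z}$ or $\mathbb{R}$ let $R\langle X_1,\dots,X_q\rangle/\mathcal{J}_k$ be the algebra of non-commutative polynomials modulo the two-sided ideal $\mathcal{J}_k$ generated by the polynomials of degree $\ge k$; for $R=\mathbb{R}$ it is identified, through the coefficients, with the Euclidean space of dimension $\sum_{\ell=0}^{k-1}q^\ell$. Let $\mathcal{M}$ be the Magnus expansion modulo degree $k$, $\mathcal{M}(x_i)=1+X_i$, a homomorphism from $F/F_k$ to the group of units of $\mathbb{Z}\langle X_1,\dots,X_q\rangle/\mathcal{J}_k\subset\mathbb{R}\langle X_1,\dots,X_q\rangle/\mathcal{J}_k$. For words $J$, $K$ in the letters $1,\dots,q$, let $\mathrm{Sh}(J,K)$ be the finite multiset of resulting shuffles of $J$ and $K$: a word $L=c_1\cdots c_n$ is counted once for every pair of strictly increasing sequences of positions $\alpha(1)<\dots<\alpha(|J|)$ and $\beta(1)<\dots<\beta(|K|)$ in $\{1,\dots,n\}$ such that $c_{\alpha(i)}$ is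 the $i$-th letter of $J$ for all $i$, $c_{\beta(j)}$ is the $j$-th letter of $K$ for all $j$, and each position in $\{1,\dots,n\}$ is an $\alpha(i)$, or a $\beta(j)$, or both. Let $$\mathrm{Im}(\mathcal{M}_{\mathbb{R}})=\Bigl\{\sum_I a_I X_I\in\mathbb{R}\langle X_1,\dots,X_q\rangle/\mathcal{J}_k \ \Bigm|\ a_\emptyset=1,\ \ a_Ja_K=\sum_{L\in\mathrm{Sh}(J,K)}a_L\ \text{ whenever } |J|+|K|<k\Bigr\},$$ with the subspace topology. Then $F/F_k$ acts freely on $\mathrm{Im}(\mathcal{M}_{\mathbb{R}})$ by right multiplication, $a\mapsto a\cdot\mathcal{M}(g)$. Moreover $\mathrm{Im}(\mathcal{M}_{\mathbb{R}})$ is a smooth embedded submanifold of the Euclidean space, and the quotient $\mathrm{Im}(\mathcal{M}_{\mathbb{R}})/(F/F_k)$, with the quotient topology, is a closed (compact, Hausdorff, second countable, without boundary) connected $C^\infty$-manifold, with the smooth structure for which the projection from $\mathrm{Im}(\mathcal{M}_{\mathbb{R}})$ is a local diffeomorphism. It is an Eilenberg–MacLane space $K(F/F_k,1)$: it is path connected,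 its fundamental group at every base point is isomorphic to $F/F_k$, and its homotopy groups in degrees $\ge 2$ vanish. -/

import Mathlib

open scoped Manifold ContDiff Topology

/-! ### The truncated algebra of non-commutative polynomials -/

/-- Words of length `< k` in the letters `0, …, q - 1`, i.e. the non-commutative monomials
`X_{i_1} ⋯ X_{i_n}` with `n < k`. -/
abbrev Word (q k : ℕ) : Type := {w : List (Fin q) // w.length < k}

namespace Word

variable {q k : ℕ}

/-- The prefix of length `i` of a word. -/
def take (w : Word q k) (i : ℕ) : Word q k :=
  ⟨w.1.take i, lt_of_le_of_lt (List.length_take_le' i w.1) w.2⟩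

/-- The word without its first `i` letters. -/
def drop (w : Word q k) (i : ℕ) : Word q k :=
  ⟨w.1.drop i, lt_of_le_of_lt (by simp) w.2⟩

end Word

instance wordFinite (q k : ℕ) : Finite (Word q k) := by
  have h := List.finite_length_lt (Fin q) k
  exact h.to_subtype

noncomputable instance wordFintype (q k : ℕ) : Fintype (Word q k) := Fintype.ofFinite _

/-- The algebra `R⟨X_1, …, X_q⟩ / J_k`, where `J_k` is the two-sided ideal generated by the
polynomials of degree at least `k`. An element `∑ a_I X_I` is given by its coefficients
`a_I`, `I` running over the words of length `< k`. -/
def TruncAlg (R : Type*) (q k : ℕ) : Type _ := Word q k → R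

namespace TruncAlg

variable {R : Type*} {q k : ℕ}

@[ext] theorem ext {f g : TruncAlg R q k} (h : ∀ w, f w = g w) : f = g := funext h

section Ring

variable [CommRing R]

instance : AddCommGroup (TruncAlg R q k) := inferInstanceAs (AddCommGroup (Word q k → R))

instance : Module R (TruncAlg R q k) := inferInstanceAs (Module R (Word q k → R))

/-- The empty word has coefficient `1`, all others have coefficient `0`. -/
instance : One (TruncAlg R q k) := ⟨fun w => if w.1 = [] then 1 else 0⟩

/-- Multiplication by concatenation of monomials:
`(f g)_w` is the sum of `f_u g_v` over all the factorizations `w = u v`. -/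
instance : Mul (TruncAlg R q k) :=
  ⟨fun f g w => ∑ i ∈ Finset.range (w.1.length + 1), f (w.take i) * g (w.drop i)⟩

theorem add_apply (f g : TruncAlg R q k) (w : Word q k) : (f + g) w = f w + g w := rfl

theorem sub_apply (f g : TruncAlg R q k) (w : Word q k) : (f - g) w = f w - g w := rfl

theorem zero_apply (w : Word q k) : (0 : TruncAlg R q k) w = 0 := rfl

theorem one_apply (w : Word q k) : (1 : TruncAlg R q k) w = if w.1 = [] then 1 else 0 := rfl

theorem mul_apply (f g : TruncAlg R q k) (w : Word q k) :
    (f * g) w = ∑ i ∈ Finset.range (w.1.length + 1), f (w.take i) * g (w.drop i) := rfl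

protected theorem mul_assoc (f g h : TruncAlg R q k) : f * g * h = f * (g * h) := by
  ext w
  simp only [mul_apply, Finset.sum_mul, Finset.mul_sum]
  rw [Finset.sum_sigma', Finset.sum_sigma']
  refine Finset.sum_nbij' (fun p => ⟨p.2, p.1 - p.2⟩) (fun p => ⟨p.1 + p.2, p.1⟩) ?_ ?_ ?_ ?_ ?_
  · rintro ⟨i, j⟩ hp
    simp [Word.take, Word.drop] at hp ⊢
    omega
  · rintro ⟨i, j⟩ hp
    simp [Word.take, Word.drop] at hp ⊢
    omega
  · rintro ⟨i, j⟩ hp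
    simp [Word.take] at hp ⊢
    omega
  · rintro ⟨i, j⟩ hp
    simp
  · rintro ⟨i, j⟩ hp
    simp [Word.take] at hp
    have h1 : (w.take i).take j = w.take j := by
      apply Subtype.ext
      simp only [Word.take, List.take_take]
      congr 1
      omega
    have h2 : (w.take i).drop j = (w.drop j).take (i - j) := by
      apply Subtype.ext
      simp only [Word.take, Word.drop, List.drop_take]
    have h3 : (w.drop j).drop (i - j) = w.drop i := by
      apply Subtype.ext
      simp only [Word.drop, List.drop_drop]
      congr 1
      omega
    simp only [h1, h2, h3, mul_assoc]

protected theorem one_mul (f : TruncAlg R q k) : 1 * f = f := by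
  ext w
  rw [mul_apply, Finset.sum_eq_single 0]
  · simp [one_apply, Word.take, Word.drop]
  · intro i hi h0
    have : ¬ (w.take i).1 = [] := by
      intro h
      simp only [Word.take, List.take_eq_nil_iff] at h
      rcases h with h | h
      · exact h0 h
      · rw [h] at hi
        simp at hi
        exact h0 hi
    simp [one_apply, this]
  · simp

protected theorem mul_one (f : TruncAlg R q k) : f * 1 = f := by
  ext w
  rw [mul_apply, Finset.sum_eq_single w.1.length]
  · simp [one_apply, Word.take, Word.drop]
  · intro i hi h0
    have : ¬ (w.drop i).1 = [] := by
      intro h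
      simp only [Word.drop, List.drop_eq_nil_iff] at h
      simp only [Finset.mem_range] at hi
      omega
    simp [one_apply, this]
  · simp

noncomputable instance : Ring (TruncAlg R q k) :=
  { (inferInstance : AddCommGroup (TruncAlg R q k)),
    (inferInstance : One (TruncAlg R q k)),
    (inferInstance : Mul (TruncAlg R q k)) with
    mul_assoc := TruncAlg.mul_assoc
    one_mul := TruncAlg.one_mul
    mul_one := TruncAlg.mul_one
    left_distrib := fun f g h => by
      ext w
      simp [mul_apply, add_apply, mul_add, Finset.sum_add_distrib]
    right_distrib := fun f g h => by
      ext w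
      simp [mul_apply, add_apply, add_mul, Finset.sum_add_distrib]
    zero_mul := fun f => by
      ext w
      simp [mul_apply, zero_apply]
    mul_zero := fun f => by
      ext w
      simp [mul_apply, zero_apply] }

/-- `f` has no terms of degree less than `n`. -/
def OrderGE (n : ℕ) (f : TruncAlg R q k) : Prop := ∀ w : Word q k, w.1.length < n → f w = 0

theorem OrderGE.mul {m n : ℕ} {f g : TruncAlg R q k} (hf : OrderGE m f) (hg : OrderGE n g) :
    OrderGE (m + n) (f * g) := by
  intro w hw
  rw [mul_apply]
  refine Finset.sum_eq_zero fun i hi => ?_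
  rw [Finset.mem_range] at hi
  by_cases h : i < m
  · rw [hf _ (lt_of_le_of_lt (by simp [Word.take]) h), zero_mul]
  · rw [hg _ (by simp [Word.drop]; omega), mul_zero]

theorem OrderGE.mul_right {m : ℕ} {f : TruncAlg R q k} (hf : OrderGE m f)
    (g : TruncAlg R q k) : OrderGE m (f * g) :=
  hf.mul (n := 0) fun _ h => absurd h (Nat.not_lt_zero _)

theorem OrderGE.mul_left {m : ℕ} {f : TruncAlg R q k} (hf : OrderGE m f)
    (g : TruncAlg R q k) : OrderGE m (g * f) := by
  have h := OrderGE.mul (m := 0) (f := g) (fun _ h => absurd h (Nat.not_lt_zero _)) hf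
  rwa [zero_add] at h

theorem OrderGE.add {m : ℕ} {f g : TruncAlg R q k} (hf : OrderGE m f) (hg : OrderGE m g) :
    OrderGE m (f + g) := fun w hw => by rw [add_apply, hf w hw, hg w hw, add_zero]

theorem OrderGE.sub {m : ℕ} {f g : TruncAlg R q k} (hf : OrderGE m f) (hg : OrderGE m g) :
    OrderGE m (f - g) := fun w hw => by rw [sub_apply, hf w hw, hg w hw, sub_zero]

theorem OrderGE.eq_zero {f : TruncAlg R q k} (hf : OrderGE k f) : f = 0 :=
  TruncAlg.ext fun w => hf w w.2

/-- The class of the indeterminate `X_i`. -/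
def X (i : Fin q) : TruncAlg R q k := fun w => if w.1 = [i] then 1 else 0

theorem orderGE_X (i : Fin q) : OrderGE 1 (X i : TruncAlg R q k) := by
  intro w hw
  have : w.1 = [] := List.length_eq_zero_iff.mp (by omega)
  simp [X, this]

theorem orderGE_neg_X_pow (i : Fin q) (n : ℕ) :
    OrderGE n ((-X i : TruncAlg R q k) ^ n) := by
  induction n with
  | zero => exact fun _ h => absurd h (Nat.not_lt_zero _)
  | succ n ih =>
    rw [pow_succ]
    refine ih.mul ?_
    have h := OrderGE.sub (f := (0 : TruncAlg R q k)) (fun _ _ => rfl) (orderGE_X i)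
    rwa [zero_sub] at h

/-- The unit `1 + X_i`, whose inverse is `1 - X_i + X_i ^ 2 - ⋯ + (-1) ^ (k - 1) X_i ^ (k - 1)`. -/
noncomputable def oneAddX (i : Fin q) : (TruncAlg R q k)ˣ where
  val := 1 + X i
  inv := ∑ j ∈ Finset.range k, (-X i) ^ j
  val_inv := by
    have h := mul_neg_geom_sum (-X i : TruncAlg R q k) k
    rw [sub_neg_eq_add, (orderGE_neg_X_pow i k).eq_zero, sub_zero] at h
    exact h
  inv_val := by
    have h := geom_sum_mul_neg (-X i : TruncAlg R q k) k
    rw [sub_neg_eq_add, (orderGE_neg_X_pow i k).eq_zero, sub_zero] at h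
    exact h

end Ring

/-- The topology and the smooth structure of `ℝ⟨X_1, …, X_q⟩ / J_k` are those of the real vector
space with the coefficients as coordinates. -/
noncomputable instance : NormedAddCommGroup (TruncAlg ℝ q k) :=
  inferInstanceAs (NormedAddCommGroup (Word q k → ℝ))

noncomputable instance : NormedSpace ℝ (TruncAlg ℝ q k) :=
  inferInstanceAs (NormedSpace ℝ (Word q k → ℝ))

end TruncAlg

/-! ### The nilpotent quotient of the free group and the Magnus expansion -/

/-- `F / F_k`, where `F` is the free group of rank `q`, `F_1 = F` and `F_k = [F_{k-1}, F]`.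
(In Mathlib the lower central series starts with index `0`.) -/
abbrev FreeNilpotent (q k : ℕ) : Type :=
  FreeGroup (Fin q) ⧸ (⊤ : Subgroup (FreeGroup (Fin q))).lowerCentralSeries (k - 1)

open TruncAlg in
/-- The Magnus expansion `x_i ↦ 1 + X_i` modulo degree `k`, on the free group. -/
noncomputable def magnus (R : Type*) [CommRing R] (q k : ℕ) :
    FreeGroup (Fin q) →* (TruncAlg R q k)ˣ :=
  FreeGroup.lift oneAddX

open TruncAlg in
theorem orderGE_magnus_sub_one (R : Type*) [CommRing R] (q k : ℕ) (x : FreeGroup (Fin q)) :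
    OrderGE 1 ((magnus R q k x : TruncAlg R q k) - 1) := by
  induction x using FreeGroup.induction_on with
  | C1 =>
    rw [map_one, Units.val_one, sub_self]
    exact fun _ _ => rfl
  | of i =>
    have h : (magnus R q k (FreeGroup.of i) : TruncAlg R q k) - 1 = X i := by
      simp [magnus, oneAddX]
    rw [h]
    exact orderGE_X i
  | inv_of i hi =>
    have h : (magnus R q k (FreeGroup.of i)⁻¹ : TruncAlg R q k) - 1 =
        0 - (magnus R q k (FreeGroup.of i)⁻¹ : TruncAlg R q k) *
          ((magnus R q k (FreeGroup.of i) : TruncAlg R q k) - 1) := by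
      rw [mul_sub, mul_one, ← Units.val_mul, ← map_mul]
      simp
    change OrderGE 1 ((magnus R q k (FreeGroup.of i)⁻¹ : TruncAlg R q k) - 1)
    rw [h]
    exact OrderGE.sub (fun _ _ => rfl) (hi.mul_left _)
  | mul x y hx hy =>
    have h : (magnus R q k (x * y) : TruncAlg R q k) - 1 =
        ((magnus R q k x : TruncAlg R q k) - 1) * (magnus R q k y : TruncAlg R q k) +
          ((magnus R q k y : TruncAlg R q k) - 1) := by
      rw [map_mul, Units.val_mul]
      noncomm_ring
    rw [h]
    exact (hx.mul_right _).add hy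

open TruncAlg in
/-- The units `u` with `u - 1` of order at least `n`. -/
def congruenceUnits (R : Type*) [CommRing R] (q k n : ℕ) : Subgroup (TruncAlg R q k)ˣ where
  carrier := {u | OrderGE n ((u : TruncAlg R q k) - 1)}
  one_mem' := by
    change OrderGE n _
    rw [Units.val_one, sub_self]
    exact fun _ _ => rfl
  mul_mem' := by
    intro u v hu hv
    have h : ((u * v : (TruncAlg R q k)ˣ) : TruncAlg R q k) - 1 =
        ((u : TruncAlg R q k) - 1) * (v : TruncAlg R q k) + ((v : TruncAlg R q k) - 1) := by
      rw [Units.val_mul]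
      noncomm_ring
    change OrderGE n _
    rw [h]
    exact (OrderGE.mul_right hu _).add hv
  inv_mem' := by
    intro u hu
    have h : ((u⁻¹ : (TruncAlg R q k)ˣ) : TruncAlg R q k) - 1 =
        0 - ((u⁻¹ : (TruncAlg R q k)ˣ) : TruncAlg R q k) * ((u : TruncAlg R q k) - 1) := by
      rw [mul_sub, mul_one, Units.inv_mul]
      abel
    change OrderGE n _
    rw [h]
    exact OrderGE.sub (fun _ _ => rfl) (OrderGE.mul_left hu _)

open TruncAlg in
open scoped commutatorElement in
theorem lowerCentralSeries_le_comap_magnus (R : Type*) [CommRing R] (q k n : ℕ) :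
    (⊤ : Subgroup (FreeGroup (Fin q))).lowerCentralSeries n ≤
      (congruenceUnits R q k (n + 1)).comap (magnus R q k) := by
  induction n with
  | zero => exact fun x _ => orderGE_magnus_sub_one R q k x
  | succ n ih =>
    rw [Subgroup.lowerCentralSeries_succ, Subgroup.commutator_le]
    intro x hx y _
    have hu : OrderGE (n + 1) ((magnus R q k x : TruncAlg R q k) - 1) := ih hx
    have hv := orderGE_magnus_sub_one R q k y
    change OrderGE (n + 1 + 1) ((magnus R q k ⁅x, y⁆ : TruncAlg R q k) - 1)
    rw [commutatorElement_def, map_mul, map_mul, map_mul, map_inv, map_inv]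
    generalize magnus R q k x = u at hu ⊢
    generalize magnus R q k y = v at hv ⊢
    have h : ((u * v * u⁻¹ * v⁻¹ : (TruncAlg R q k)ˣ) : TruncAlg R q k) - 1 =
        (((u : TruncAlg R q k) - 1) * ((v : TruncAlg R q k) - 1) -
          ((v : TruncAlg R q k) - 1) * ((u : TruncAlg R q k) - 1)) *
          ((u⁻¹ * v⁻¹ : (TruncAlg R q k)ˣ) : TruncAlg R q k) := by
      have h1 : ((u : TruncAlg R q k) - 1) * ((v : TruncAlg R q k) - 1) -
          ((v : TruncAlg R q k) - 1) * ((u : TruncAlg R q k) - 1) =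
          ((u * v : (TruncAlg R q k)ˣ) : TruncAlg R q k) -
          ((v * u : (TruncAlg R q k)ˣ) : TruncAlg R q k) := by
        rw [Units.val_mul, Units.val_mul]
        noncomm_ring
      rw [h1, sub_mul, ← Units.val_mul, ← Units.val_mul]
      have h2 : v * u * (u⁻¹ * v⁻¹) = 1 := by group
      rw [h2, Units.val_one, mul_assoc (u * v)]
    rw [h]
    refine OrderGE.mul_right (OrderGE.sub (hu.mul hv) ?_) _
    rw [add_comm (n + 1) 1]
    exact hv.mul hu

/-- The Magnus expansion on `F / F_k`. -/
noncomputable def magnusBar (R : Type*) [CommRing R] (q k : ℕ) :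
    FreeNilpotent q k →* (TruncAlg R q k)ˣ :=
  QuotientGroup.lift _ (magnus R q k) fun x hx => by
    have h : TruncAlg.OrderGE (k - 1 + 1) ((magnus R q k x : TruncAlg R q k) - 1) :=
      lowerCentralSeries_le_comap_magnus R q k (k - 1) hx
    refine Units.ext (sub_eq_zero.mp (TruncAlg.ext fun w => h w ?_))
    have := w.2
    omega

/-! ### The shuffle relations and the quotient space -/

/-- The multiplicity of the word `L` as a resulting shuffle of the words `J` and `K`: the number of
pairs of strictly increasing sequences of positions `α(1) < ⋯ < α(|J|)` and `β(1) < ⋯ < β(|K|)` in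
`L` such that `J` is read off at `α`, `K` is read off at `β`, and every position of `L` is an `α(i)`
or a `β(j)` or both. -/
noncomputable def shuffleCount {q : ℕ} (J K L : List (Fin q)) : ℕ :=
  Nat.card {p : (Fin J.length ↪o Fin L.length) × (Fin K.length ↪o Fin L.length) //
    (∀ i, L.get (p.1 i) = J.get i) ∧ (∀ j, L.get (p.2 j) = K.get j) ∧
      ∀ s, (∃ i, p.1 i = s) ∨ (∃ j, p.2 j = s)}

/-- The elements `∑ a_I X_I` of `ℝ⟨X_1, …, X_q⟩ / J_k` with constant term `1` which satisfy the
shuffle relations `a_J a_K = ∑_{L ∈ Sh(J, K)} a_L`, for all `J` and `K` such that all shuffles of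
`J` and `K` have length `< k`. -/
def realMagnusImage (q k : ℕ) : Set (TruncAlg ℝ q k) :=
  {a | (∀ w : Word q k, w.1 = [] → a w = 1) ∧
    ∀ J K : Word q k, J.1.length + K.1.length < k →
      a J * a K = ∑ L : Word q k, (shuffleCount J.1 K.1 L.1 : ℝ) * a L}

/-- Two points are equivalent if they are in the same orbit of the action of `F / F_k` by right
multiplication with the values of the Magnus expansion. -/
def magnusSetoid (q k : ℕ) : Setoid (realMagnusImage q k) where
  r a b := ∃ g : FreeNilpotent q k, (b : TruncAlg ℝ q k) = a * magnusBar ℝ q k g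
  iseqv :=
    { refl := fun a => ⟨1, by simp⟩
      symm := fun {a b} ⟨g, hg⟩ => ⟨g⁻¹, by rw [hg, mul_assoc, ← Units.val_mul, ← map_mul]; simp⟩
      trans := fun {a b c} ⟨g, hg⟩ ⟨h, hh⟩ =>
        ⟨g * h, by rw [hh, hg, mul_assoc, ← Units.val_mul, ← map_mul]⟩ }

/-- The space of orbits, with the quotient topology. -/
abbrev MagnusQuotient (q k : ℕ) : Type := Quotient (magnusSetoid q k)

/-- `X` is an Eilenberg–MacLane space `K(G, 1)`: it is path connected, its fundamental group is
isomorphic to `G`, and its higher homotopy groups vanish. -/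
structure IsEilenbergMacLaneOne (X : Type*) [TopologicalSpace X] (G : Type*) [Group G] :
    Prop where
  pathConnected : PathConnectedSpace X
  pi_one : ∀ x : X, Nonempty (FundamentalGroup X x ≃* G)
  pi_higher : ∀ n : ℕ, 2 ≤ n → ∀ x : X, Subsingleton (π_ n X x)

/-!
The space `realMagnusImage q k` consists of the group-like elements of the truncated algebra for a
shuffle product with overlaps, and `F / F_k` sits in it as a lattice. Everything rests on
coordinates indexed by the Lyndon words of length `< k`.

*Lyndon commutators.* A Lyndon word is bracketed recursively, according to its standard
factorization. By a rewriting argument with the Jacobi identity (`commutator_lyndonElt_mem`) the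
Lyndon commutators of weight `n` generate `F_n` modulo `F_{n+1}`. On the other hand the leading part
of the Magnus expansion of the commutator of `w` is `w` plus larger words
(`magnus_lyndonElt_apply`). By triangularity an element of `F_n` without terms of degree `n` in its Magnus expansion lies
in `F_{n+1}`. This is Magnus's theorem `magnusBar_injective`, from which freeness follows, as the
elements of `realMagnusImage q k` are invertible.

*Shuffles.* The number of shuffles satisfies a recursion on the first letter
(`shuffleCount_eq_infil`), so it is compatible with deconcatenation (`infil_append`). Hence
`realMagnusImage q k` is closed under multiplication. It contains the values of the Magnus
expansion, and the real powers `u ^ t` of its elements, since the coefficients of `u ^ t` are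
polynomials in `t` (`unipotentPow_mem`).

*Lyndon coordinates.* The lowest degree part of the difference of two elements of
`realMagnusImage q k` is annihilated by proper shuffles. By Ree's theorem
(`natCast_mul_eq_sum_dynkin`) it is a combination of brackets, so it is determined by the
coefficients of the Lyndon words (`realMagnusImage_ext`). Conversely these coefficients can be
prescribed, one after the other, by multiplying with real powers of the Magnus expansions of Lyndon
commutators (`exists_contDiff_lyndon_section`). Therefore `realMagnusImage q k` is the graph of a
smooth map over the space of Lyndon coordinates, that is, an embedded submanifold diffeomorphic to a
Euclidean space. Using integral powers instead, every point can be moved by `F / F_k` into the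
unit cube (`exists_magnus_mul_mem_Icc`), so the quotient is compact.

*The quotient.* The values of the Magnus expansion have integer coefficients, so the action is
properly discontinuous and the projection is a covering map. The group acts by smooth maps, which
makes the quotient a manifold. Its universal cover is a Euclidean space, so its fundamental
group is `F / F_k`, and its higher homotopy groups vanish, as loops of dimension at least `2` lift
to the cover.
-/

open TruncAlg

/-! ### Lyndon words and their standard factorization -/

section Lyndon

variable {α : Type*} [LinearOrder α]

theorem List.lt_append_self {u t : List α} (ht : t ≠ []) : u < u ++ t := by
  induction u with
  | nil =>
    cases t with
    | nil => exact absurd rfl ht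
    | cons a t => exact List.nil_lt_cons a t
  | cons a u ih => exact List.cons_lt_cons_iff.mpr (Or.inr ⟨rfl, ih⟩)

/-- If `u < v` lexicographically, then either `u` is a proper prefix of `v`, or `u` and `v` differ
at some position, and then the comparison is not affected by appending letters. -/
theorem List.lt_cases {u v : List α} (h : u < v) :
    (∃ t, t ≠ [] ∧ v = u ++ t) ∨ ∀ s t : List α, u ++ s < v ++ t := by
  induction u generalizing v with
  | nil => exact Or.inl ⟨v, by rintro rfl; exact lt_irrefl _ h, rfl⟩
  | cons a u ih =>
    cases v with
    | nil => exact absurd h (List.not_lt_nil _)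
    | cons b v =>
      rcases List.cons_lt_cons_iff.mp h with hab | ⟨rfl, huv⟩
      · exact Or.inr fun s t => List.cons_lt_cons_iff.mpr (Or.inl hab)
      · rcases ih huv with ⟨t, ht, rfl⟩ | h'
        · exact Or.inl ⟨t, ht, rfl⟩
        · exact Or.inr fun s t => List.cons_lt_cons_iff.mpr (Or.inr ⟨rfl, h' s t⟩)

theorem List.append_lt_append_left_iff {u s t : List α} : u ++ s < u ++ t ↔ s < t := by
  induction u with
  | nil => rfl
  | cons a u ih => simp [ih]

theorem List.append_lt_append_of_length_le {u v : List α} (h : u < v) (hl : v.length ≤ u.length)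
    (s t : List α) : u ++ s < v ++ t := by
  rcases List.lt_cases h with ⟨r, hr, rfl⟩ | h'
  · have := List.length_pos_iff.mpr hr
    rw [List.length_append] at hl
    omega
  · exact h' s t

/-- A Lyndon word is a nonempty word which is smaller than all its proper nonempty suffixes. -/
def IsLyndon (w : List α) : Prop :=
  w ≠ [] ∧ ∀ u v : List α, w = u ++ v → u ≠ [] → v ≠ [] → w < v

theorem isLyndon_singleton (a : α) : IsLyndon [a] := by
  refine ⟨by simp, fun u v h hu hv => ?_⟩
  have h1 := congrArg List.length h
  have h2 := List.length_pos_iff.mpr hu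
  have h3 := List.length_pos_iff.mpr hv
  simp at h1
  omega

theorem IsLyndon.append_lt_right {u v : List α} (hv : IsLyndon v) (h : u < v) (hu : u ≠ []) :
    u ++ v < v := by
  rcases List.lt_cases h with ⟨t, ht, rfl⟩ | h'
  · exact List.append_lt_append_left_iff.mpr (hv.2 u t rfl hu ht)
  · simpa using h' v []

theorem IsLyndon.append {u v : List α} (hu : IsLyndon u) (hv : IsLyndon v) (h : u < v) :
    IsLyndon (u ++ v) := by
  have huv := hv.append_lt_right h hu.1
  refine ⟨by simp [hu.1], fun x y hxy hx hy => ?_⟩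
  rcases List.append_eq_append_iff.mp hxy with ⟨z, rfl, rfl⟩ | ⟨z, rfl, rfl⟩
  · by_cases hz : z = []
    · subst hz
      simpa using huv
    · exact huv.trans (hv.2 z y rfl hz hy)
  · by_cases hz : z = []
    · subst hz
      simpa using huv
    · refine List.append_lt_append_of_length_le (hu.2 x z rfl hx hz) ?_ v v
      simp

/-- The smallest nonempty suffix of a nonempty word. -/
def minSuffix : List α → List α
  | [] => []
  | [a] => [a]
  | a :: b :: w => min (a :: b :: w) (minSuffix (b :: w))

theorem minSuffix_spec (w : List α) (hw : w ≠ []) :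
    minSuffix w ≠ [] ∧ (∃ u, w = u ++ minSuffix w) ∧
      ∀ u v : List α, w = u ++ v → v ≠ [] → minSuffix w ≤ v := by
  induction w using minSuffix.induct with
  | case1 => exact absurd rfl hw
  | case2 a =>
    refine ⟨by simp [minSuffix], ⟨[], by simp [minSuffix]⟩, fun u v h hv => ?_⟩
    cases u with
    | nil => simp [minSuffix, h]
    | cons c u =>
      simp at h
      exact absurd h.2.2 hv
  | case3 a b w ih =>
    obtain ⟨h1, ⟨u, hu⟩, h3⟩ := ih (by simp)
    rw [minSuffix]
    refine ⟨?_, ?_, fun x y hxy hy => ?_⟩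
    · rcases min_choice (a :: b :: w) (minSuffix (b :: w)) with h | h <;> rw [h]
      · simp
      · exact h1
    · rcases min_choice (a :: b :: w) (minSuffix (b :: w)) with h | h <;> rw [h]
      · exact ⟨[], rfl⟩
      · exact ⟨a :: u, by rw [List.cons_append, ← hu]⟩
    · cases x with
      | nil =>
        rw [hxy]
        exact min_le_left _ _
      | cons c x =>
        rw [List.cons_append, List.cons.injEq] at hxy
        exact (min_le_right _ _).trans (h3 x y hxy.2 hy)

/-- The right factor of the standard factorization: the smallest proper nonempty suffix. -/
def rightFactor (w : List α) : List α := minSuffix w.tail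

/-- The left factor of the standard factorization. -/
def leftFactor (w : List α) : List α := w.take (w.length - (rightFactor w).length)

theorem factor_spec {w : List α} (hw : 2 ≤ w.length) :
    w = leftFactor w ++ rightFactor w ∧ leftFactor w ≠ [] ∧ rightFactor w ≠ [] ∧
      ∀ u v : List α, w = u ++ v → u ≠ [] → v ≠ [] → rightFactor w ≤ v := by
  match w, hw with
  | a :: b :: w, _ =>
    obtain ⟨h1, ⟨u, hu⟩, h3⟩ := minSuffix_spec (b :: w) (by simp)
    have hr : rightFactor (a :: b :: w) = minSuffix (b :: w) := rfl
    have hl : leftFactor (a :: b :: w) = a :: u := by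
      rw [leftFactor, hr]
      generalize minSuffix (b :: w) = m at hu
      rw [hu, ← List.cons_append, List.length_append, Nat.add_sub_cancel, List.take_left]
    rw [hr, hl]
    refine ⟨by rw [List.cons_append, ← hu], by simp, h1, fun x y hxy hx hy => ?_⟩
    cases x with
    | nil => exact absurd rfl hx
    | cons c x =>
      rw [List.cons_append, List.cons.injEq] at hxy
      exact h3 x y hxy.2 hy

theorem length_leftFactor_add {w : List α} (hw : 2 ≤ w.length) :
    (leftFactor w).length + (rightFactor w).length = w.length := by
  conv_rhs => rw [(factor_spec hw).1]
  simp

theorem length_leftFactor_pos {w : List α} (hw : 2 ≤ w.length) : 0 < (leftFactor w).length :=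
  List.length_pos_iff.mpr (factor_spec hw).2.1

theorem length_rightFactor_pos {w : List α} (hw : 2 ≤ w.length) : 0 < (rightFactor w).length :=
  List.length_pos_iff.mpr (factor_spec hw).2.2.1

theorem factor_unique {w u v : List α} (h : w = u ++ v) (hu : u ≠ []) (hv : v ≠ [])
    (hmin : ∀ x y : List α, w = x ++ y → x ≠ [] → y ≠ [] → v ≤ y) :
    leftFactor w = u ∧ rightFactor w = v := by
  have hw : 2 ≤ w.length := by
    have h2 := List.length_pos_iff.mpr hu
    have h3 := List.length_pos_iff.mpr hv
    rw [h, List.length_append]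
    omega
  obtain ⟨h1, h2, h3, h4⟩ := factor_spec hw
  have hr : rightFactor w = v := le_antisymm (h4 u v h hu hv) (hmin _ _ h1 h2 h3)
  rw [hr] at h1
  exact ⟨(List.append_cancel_right (h.symm.trans h1)).symm, hr⟩

/-- The smallest proper nonempty suffix of any word is a Lyndon word. -/
theorem IsLyndon.rightFactor {w : List α} (hw : 2 ≤ w.length) : IsLyndon (rightFactor w) := by
  obtain ⟨h1, h2, h3, h4⟩ := factor_spec hw
  refine ⟨h3, fun x y hxy hx hy => lt_of_le_of_ne ?_ ?_⟩
  · refine h4 (leftFactor w ++ x) y ?_ (by simp [h2]) hy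
    rw [List.append_assoc, ← hxy, ← h1]
  · intro he
    rw [he] at hxy
    simp [hx] at hxy

theorem IsLyndon.leftFactor {w : List α} (hl : IsLyndon w) (hw : 2 ≤ w.length) :
    IsLyndon (leftFactor w) := by
  obtain ⟨h1, h2, h3, h4⟩ := factor_spec hw
  refine ⟨h2, fun x y hxy hx hy => ?_⟩
  have hw' : w = x ++ (y ++ _root_.rightFactor w) := by rw [← List.append_assoc, ← hxy, ← h1]
  have hlt : w < y ++ _root_.rightFactor w := hl.2 _ _ hw' hx (by simp [hy])
  by_contra hcon
  have hlt' : y < _root_.leftFactor w := by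
    refine lt_of_le_of_ne (not_lt.mp hcon) ?_
    intro he
    rw [← he] at hxy
    simp [hx] at hxy
  rcases List.lt_cases hlt' with ⟨t, ht, hy'⟩ | h'
  · -- if `y` is also a prefix of the left factor, cancelling it gives a suffix that is too small
    have h5 : w = y ++ (t ++ _root_.rightFactor w) := by rw [← List.append_assoc, ← hy', ← h1]
    replace hlt := lt_of_eq_of_lt h5.symm hlt
    rw [List.append_lt_append_left_iff] at hlt
    refine absurd (h4 (y) (t ++ _root_.rightFactor w) ?_ hy (by simp [ht])) (not_le.mpr hlt)
    rw [← List.append_assoc, ← hy', ← h1]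
  · have := h' (_root_.rightFactor w) (_root_.rightFactor w)
    rw [← h1] at this
    exact lt_asymm hlt this

theorem IsLyndon.leftFactor_lt_rightFactor {w : List α} (hl : IsLyndon w) (hw : 2 ≤ w.length) :
    _root_.leftFactor w < _root_.rightFactor w := by
  obtain ⟨h1, h2, h3, h4⟩ := factor_spec hw
  have h5 : _root_.leftFactor w < w := by
    conv_rhs => rw [h1]
    exact List.lt_append_self h3
  exact h5.trans (hl.2 _ _ h1 h2 h3)

/-- For Lyndon words `u < v` such that `u` is a letter or the right factor of `u` is at least `v`,
the standard factorization of `u v` is `(u, v)`. -/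
theorem IsLyndon.factor_append {u v : List α} (hu : IsLyndon u) (hv : IsLyndon v)
    (h : u.length = 1 ∨ v ≤ _root_.rightFactor u) :
    _root_.leftFactor (u ++ v) = u ∧ _root_.rightFactor (u ++ v) = v := by
  refine factor_unique rfl hu.1 hv.1 fun x y hxy hx hy => ?_
  rcases List.append_eq_append_iff.mp hxy with ⟨z, rfl, rfl⟩ | ⟨z, rfl, rfl⟩
  · by_cases hz : z = []
    · subst hz
      simp
    · exact (hv.2 z y rfl hz hy).le
  · by_cases hz : z = []
    · subst hz
      simp
    · have hx' := List.length_pos_iff.mpr hx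
      have hz' := List.length_pos_iff.mpr hz
      have hlen : 2 ≤ (x ++ z).length := by rw [List.length_append]; omega
      rcases h with h | h
      · omega
      · exact (h.trans ((factor_spec hlen).2.2.2 x z rfl hx hz)).trans
          (List.lt_append_self hv.1).le

end Lyndon

/-! ### Commutators in the lower central series -/

section LowerCentral

open scoped commutatorElement

variable {G : Type*} [Group G]

/-- The lower central series indexed from `1`: the subgroup generated by the commutators of weight
at least `n` (and the whole group for `n = 0`). -/
abbrev lcsWeight (G : Type*) [Group G] (n : ℕ) : Subgroup G :=
  (⊤ : Subgroup G).lowerCentralSeries (n - 1)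

/-- A commutator of elements of weights `m + 1` and `n + 1` has weight `m + n + 2`. -/
theorem commutator_lowerCentralSeries_le (m n : ℕ) :
    ⁅(⊤ : Subgroup G).lowerCentralSeries m, (⊤ : Subgroup G).lowerCentralSeries n⁆ ≤
      (⊤ : Subgroup G).lowerCentralSeries (m + n + 1) := by
  induction n generalizing m with
  | zero => exact le_rfl
  | succ n ih =>
    -- the three subgroups lemma in the quotient by `N`
    set N := (⊤ : Subgroup G).lowerCentralSeries (m + (n + 1) + 1) with hN
    have key : ∀ H : Subgroup G, H ≤ N ↔ H.map (QuotientGroup.mk' N) = ⊥ := fun H => by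
      rw [Subgroup.map_eq_bot_iff, QuotientGroup.ker_mk']
    rw [Subgroup.commutator_comm, key, Subgroup.lowerCentralSeries_succ, Subgroup.map_commutator,
      Subgroup.map_commutator]
    apply Subgroup.commutator_commutator_eq_bot_of_rotate
    · rw [← Subgroup.map_commutator, ← Subgroup.map_commutator, ← key, Subgroup.commutator_comm ⊤]
      refine (ih (m + 1)).trans (le_of_eq ?_)
      rw [hN]
      congr 1
      omega
    · rw [← Subgroup.map_commutator, ← Subgroup.map_commutator, ← key]
      exact Subgroup.commutator_mono (ih m) le_rfl

theorem lcsWeight_antitone : Antitone (lcsWeight G) := fun _ _ h =>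
  Subgroup.lowerCentralSeries_antitone _ (Nat.sub_le_sub_right h 1)

theorem commutator_mem_lcsWeight {m n p : ℕ} (hm : 1 ≤ m) (hn : 1 ≤ n) (hp : p ≤ m + n) {x y : G}
    (hx : x ∈ lcsWeight G m) (hy : y ∈ lcsWeight G n) : ⁅x, y⁆ ∈ lcsWeight G p := by
  refine Subgroup.lowerCentralSeries_antitone _ ?_
    (commutator_lowerCentralSeries_le _ _ (Subgroup.commutator_mem_commutator hx hy))
  omega

/-- The elements of weight `m` whose commutator with `y`, of weight `n`, lies in a given subgroup
containing all elements of weight `m + n + 1`. -/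
def bracketPreimage {m n : ℕ} (hm : 1 ≤ m) (hn : 1 ≤ n) {y : G} (hy : y ∈ lcsWeight G n)
    {T : Subgroup G} (hT : lcsWeight G (m + n + 1) ≤ T) : Subgroup G where
  carrier := {x | x ∈ lcsWeight G m ∧ ⁅x, y⁆ ∈ T}
  one_mem' := ⟨one_mem _, by simp⟩
  mul_mem' := by
    rintro a b ⟨ha, ha'⟩ ⟨hb, hb'⟩
    refine ⟨mul_mem ha hb, ?_⟩
    have h : ⁅a * b, y⁆ = ⁅a, ⁅b, y⁆⁆ * ⁅b, y⁆ * ⁅a, y⁆ := by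
      simp only [commutatorElement_def]
      group
    rw [h]
    refine mul_mem (mul_mem (hT ?_) hb') ha'
    exact commutator_mem_lcsWeight hm (by omega : 1 ≤ m + n) (by omega) ha
      (commutator_mem_lcsWeight hm hn le_rfl hb hy)
  inv_mem' := by
    rintro a ⟨ha, ha'⟩
    refine ⟨inv_mem ha, ?_⟩
    have h : ⁅a⁻¹, y⁆ = ⁅a⁻¹, ⁅a, y⁆⁻¹⁆ * ⁅a, y⁆⁻¹ := by
      simp only [commutatorElement_def]
      group
    rw [h]
    refine mul_mem (hT ?_) (inv_mem ha')
    exact commutator_mem_lcsWeight hm (by omega : 1 ≤ m + n) (by omega) (inv_mem ha)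
      (inv_mem (commutator_mem_lcsWeight hm hn le_rfl ha hy))

/-- Modulo elements of weight `m + n + 1`, taking the commutator with an element of weight `n` is
multiplicative on the elements of weight `m`, so it can be checked on generators. -/
theorem commutator_mem_of_closure {m n : ℕ} (hm : 1 ≤ m) (hn : 1 ≤ n) {S : Set G} {x y : G}
    {T : Subgroup G} (hT : lcsWeight G (m + n + 1) ≤ T)
    (hx : x ∈ Subgroup.closure S ⊔ lcsWeight G (m + 1)) (hy : y ∈ lcsWeight G n)
    (hS : ∀ s ∈ S, s ∈ lcsWeight G m ∧ ⁅s, y⁆ ∈ T) : ⁅x, y⁆ ∈ T := by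
  have h : Subgroup.closure S ⊔ lcsWeight G (m + 1) ≤ bracketPreimage hm hn hy hT := by
    refine sup_le ((Subgroup.closure_le _).mpr hS) fun z hz => ⟨?_, hT ?_⟩
    · exact lcsWeight_antitone (Nat.le_succ m) hz
    · exact commutator_mem_lcsWeight (by omega : 1 ≤ m + 1) hn (by omega) hz hy
  exact (h hx).2

theorem commutator_mem_comm {T : Subgroup G} {x y : G} : ⁅x, y⁆ ∈ T ↔ ⁅y, x⁆ ∈ T := by
  rw [← commutatorElement_inv, inv_mem_iff]

/-- The Jacobi identity, for elements whose commutators commute with each other. -/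
theorem commutator_jacobi {x y z : G} (h1 : Commute ⁅x, y⁆ ⁅y, z⁆) (h2 : Commute ⁅x, z⁆ ⁅y, z⁆)
    (h3 : Commute ⁅x, y⁆ ⁅x, z⁆) (h4 : Commute ⁅x, y⁆ ⁅y, ⁅x, z⁆⁆)
    (h5 : Commute ⁅x, z⁆ ⁅⁅x, y⁆, z⁆) (h6 : Commute ⁅y, z⁆ ⁅⁅x, y⁆, z⁆) :
    ⁅⁅x, y⁆, z⁆ = ⁅⁅x, z⁆, y⁆ * ⁅x, ⁅y, z⁆⁆ := by
  have e1 : x * ⁅y, z⁆ * x⁻¹ = ⁅⁅x, y⁆ * y, ⁅x, z⁆ * z⁆ := by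
    simp only [commutatorElement_def]
    group
  have e2 : x * ⁅y, z⁆ * x⁻¹ = ⁅x, ⁅y, z⁆⁆ * ⁅y, z⁆ := by
    simp only [commutatorElement_def]
    group
  have e3 : ∀ a c : G, ⁅a * y, c * z⁆ =
      a * (⁅y, c⁆ * (c * ⁅y, z⁆ * c⁻¹)) * a⁻¹ * (⁅a, c⁆ * (c * ⁅a, z⁆ * c⁻¹)) := fun a c => by
    simp only [commutatorElement_def]
    group
  have c1 : ⁅x, z⁆ * ⁅y, z⁆ * ⁅x, z⁆⁻¹ = ⁅y, z⁆ := by rw [h2.eq, mul_inv_cancel_right]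
  have c2 : ⁅⁅x, y⁆, ⁅x, z⁆⁆ = 1 := commutatorElement_eq_one_iff_commute.mpr h3
  have c3 : ⁅x, z⁆ * ⁅⁅x, y⁆, z⁆ * ⁅x, z⁆⁻¹ = ⁅⁅x, y⁆, z⁆ := by rw [h5.eq, mul_inv_cancel_right]
  have c4 : ⁅x, y⁆ * (⁅y, ⁅x, z⁆⁆ * ⁅y, z⁆) * ⁅x, y⁆⁻¹ = ⁅y, ⁅x, z⁆⁆ * ⁅y, z⁆ := by
    rw [(h4.mul_right h1).eq, mul_inv_cancel_right]
  rw [e2, e3, c1, c2, c3, c4, one_mul, mul_assoc, h6.eq, ← mul_assoc, mul_left_inj] at e1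
  rw [e1, ← commutatorElement_inv y ⁅x, z⁆, inv_mul_cancel_left]

/-- The Jacobi identity modulo commutators of higher weight, as a closure property. -/
theorem commutator_jacobi_mem {a b c : ℕ} (ha : 1 ≤ a) (hb : 1 ≤ b) (hc : 1 ≤ c) {x y z : G}
    (hx : x ∈ lcsWeight G a) (hy : y ∈ lcsWeight G b) (hz : z ∈ lcsWeight G c) {T : Subgroup G}
    (hT : lcsWeight G (a + b + c + 1) ≤ T) (h1 : ⁅⁅x, z⁆, y⁆ ∈ T) (h2 : ⁅x, ⁅y, z⁆⁆ ∈ T) :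
    ⁅⁅x, y⁆, z⁆ ∈ T := by
  set N := lcsWeight G (a + b + c + 1) with hN
  have hxy : ⁅x, y⁆ ∈ lcsWeight G (a + b) := commutator_mem_lcsWeight ha hb le_rfl hx hy
  have hxz : ⁅x, z⁆ ∈ lcsWeight G (a + c) := commutator_mem_lcsWeight ha hc le_rfl hx hz
  have hyz : ⁅y, z⁆ ∈ lcsWeight G (b + c) := commutator_mem_lcsWeight hb hc le_rfl hy hz
  have hxyz : ⁅⁅x, y⁆, z⁆ ∈ lcsWeight G (a + b + c) :=
    commutator_mem_lcsWeight (by omega) hc le_rfl hxy hz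
  have hyxz : ⁅y, ⁅x, z⁆⁆ ∈ lcsWeight G (a + b + c) :=
    commutator_mem_lcsWeight hb (by omega) (by omega) hy hxz
  let π := QuotientGroup.mk' N
  have hcomm : ∀ {m n : ℕ} {u v : G}, 1 ≤ m → 1 ≤ n → a + b + c + 1 ≤ m + n →
      u ∈ lcsWeight G m → v ∈ lcsWeight G n → Commute (π u) (π v) := by
    intro m n u v hm hn hmn hu hv
    rw [← commutatorElement_eq_one_iff_commute, ← map_commutatorElement]
    exact (QuotientGroup.eq_one_iff _).mpr (commutator_mem_lcsWeight hm hn hmn hu hv)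
  have key := commutator_jacobi (x := π x) (y := π y) (z := π z)
  simp only [← map_commutatorElement] at key
  replace key := key (hcomm (by omega) (by omega) (by omega) hxy hyz)
    (hcomm (by omega) (by omega) (by omega) hxz hyz)
    (hcomm (by omega) (by omega) (by omega) hxy hxz)
    (hcomm (by omega) (by omega) (by omega) hxy hyxz)
    (hcomm (by omega) (by omega) (by omega) hxz hxyz)
    (hcomm (by omega) (by omega) (by omega) hyz hxyz)
  rw [← map_mul] at key
  have h3 := hT (QuotientGroup.eq.mp key.symm)
  have h4 := mul_mem (mul_mem h1 h2) h3
  rwa [mul_inv_cancel_left] at h4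

/-! ### Lyndon commutators span the lower central quotients -/

variable {α : Type*} [LinearOrder α]

/-- The iterated commutator of the elements `x a` attached to a word, bracketed recursively
according to the standard factorization. It is only meaningful for Lyndon words. -/
def lyndonElt (x : α → G) (w : List α) : G :=
  if _h : 2 ≤ w.length then
    ⁅lyndonElt x (leftFactor w), lyndonElt x (rightFactor w)⁆
  else (w.head?.map x).getD 1
termination_by w.length
decreasing_by
  · have h1 := length_leftFactor_add _h
    have h2 := length_rightFactor_pos _h
    omega
  · have h1 := length_leftFactor_add _h
    have h2 := length_leftFactor_pos _h
    omega

theorem lyndonElt_singleton (x : α → G) (a : α) : lyndonElt x [a] = x a := by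
  rw [lyndonElt]
  simp

theorem lyndonElt_of_two_le (x : α → G) {w : List α} (h : 2 ≤ w.length) :
    lyndonElt x w = ⁅lyndonElt x (leftFactor w), lyndonElt x (rightFactor w)⁆ := by
  rw [lyndonElt, dif_pos h]

theorem lyndonElt_mem (x : α → G) (w : List α) : lyndonElt x w ∈ lcsWeight G w.length := by
  induction hn : w.length using Nat.strong_induction_on generalizing w with
  | _ n ih =>
    by_cases h : 2 ≤ w.length
    · have h1 := length_leftFactor_add h
      have h2 := length_rightFactor_pos h
      have h3 := length_leftFactor_pos h
      rw [lyndonElt_of_two_le x h]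
      exact commutator_mem_lcsWeight h3 h2 (by omega) (ih _ (by omega) _ rfl)
        (ih _ (by omega) _ rfl)
    · have : n - 1 = 0 := by omega
      rw [lcsWeight, this]
      exact Subgroup.mem_top _

/-- The subgroup generated by the Lyndon commutators of weight `p` on Lyndon words below `v`,
together with all elements of weight `p + 1`. -/
def lyndonSpanLT (x : α → G) (p : ℕ) (v : List α) : Subgroup G :=
  Subgroup.closure (lyndonElt x '' {w | IsLyndon w ∧ w.length = p ∧ w < v}) ⊔ lcsWeight G (p + 1)

theorem lyndonSpanLT_mono (x : α → G) (p : ℕ) {u v : List α} (h : u ≤ v) :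
    lyndonSpanLT x p u ≤ lyndonSpanLT x p v := by
  refine sup_le_sup_right (Subgroup.closure_mono (Set.image_mono ?_)) _
  rintro w ⟨h1, h2, h3⟩
  exact ⟨h1, h2, h3.trans_le h⟩

/-- The commutator of two Lyndon commutators is a product of Lyndon commutators, modulo higher
weight. If `(u, v)` is not a standard factorization, the Jacobi identity is applied to the left and
right factors of `u` and to `v`; this makes the larger one of the two words smaller. -/
theorem commutator_lyndonElt_mem [Finite α] (x : α → G) (p : ℕ) (v u : List α) (hu : IsLyndon u)
    (hv : IsLyndon v) (huv : u < v) (hp : u.length + v.length = p) :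
    ⁅lyndonElt x u, lyndonElt x v⁆ ∈ lyndonSpanLT x p v := by
  induction p using Nat.strong_induction_on generalizing u v with
  | _ p ihp =>
  have hfin : Finite {l : List α // l.length ≤ p} := (List.finite_length_le α p).to_subtype
  have hv' : v.length ≤ p := by omega
  obtain ⟨v', hvv⟩ : ∃ v' : {l : List α // l.length ≤ p}, v'.1 = v := ⟨⟨v, hv'⟩, rfl⟩
  induction v' using WellFoundedLT.induction generalizing u v with
  | _ v' ihv =>
  have hu0 := List.length_pos_iff.mpr hu.1
  have hv0 := List.length_pos_iff.mpr hv.1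
  have hT : lcsWeight G (p + 1) ≤ lyndonSpanLT x p v := le_sup_right
  by_cases hstd : u.length = 1 ∨ v ≤ rightFactor u
  · obtain ⟨h1, h2⟩ := hu.factor_append hv hstd
    have h3 : lyndonElt x (u ++ v) = ⁅lyndonElt x u, lyndonElt x v⁆ := by
      rw [lyndonElt_of_two_le x (by rw [List.length_append]; omega), h1, h2]
    rw [← h3]
    refine (le_sup_left : _ ≤ lyndonSpanLT x p v) (Subgroup.subset_closure ⟨u ++ v, ?_, rfl⟩)
    exact ⟨hu.append hv huv, by rw [List.length_append, hp], hv.append_lt_right huv hu.1⟩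
  · rw [not_or, not_le] at hstd
    obtain ⟨hu1, hstd⟩ := hstd
    have hu2 : 2 ≤ u.length := by omega
    have hll := hu.leftFactor hu2
    have hlr := IsLyndon.rightFactor hu2
    have h1 := length_leftFactor_add hu2
    have h2 := length_rightFactor_pos hu2
    have h3 := length_leftFactor_pos hu2
    have hlv : leftFactor u < v := (hu.leftFactor_lt_rightFactor hu2).trans hstd
    -- the induction hypothesis on the larger word, without regard to the order of the two words
    have hind : ∀ w z : List α, IsLyndon w → IsLyndon z → w.length + z.length = p → w < v →
        z < v → ⁅lyndonElt x w, lyndonElt x z⁆ ∈ lyndonSpanLT x p v := by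
      intro w z hw hz hwz hwv hzv
      rcases lt_trichotomy w z with h | h | h
      · exact lyndonSpanLT_mono x p hzv.le (ihv ⟨z, by omega⟩ (Subtype.mk_lt_mk.mpr
          (hvv ▸ hzv) : _ < v') z w hw hz h hwz (by omega) rfl)
      · rw [h, commutatorElement_self]
        exact one_mem _
      · rw [commutator_mem_comm]
        exact lyndonSpanLT_mono x p hwv.le (ihv ⟨w, by omega⟩ (Subtype.mk_lt_mk.mpr
          (hvv ▸ hwv) : _ < v') w z hz hw h (by omega) (by omega) rfl)
    rw [lyndonElt_of_two_le x hu2]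
    refine commutator_jacobi_mem h3 h2 hv0 (lyndonElt_mem x _) (lyndonElt_mem x _)
      (lyndonElt_mem x _) ((lcsWeight_antitone (by omega)).trans hT) ?_ ?_
    · have h4 := ihp _ (by omega) v _ hll hv hlv rfl
      refine commutator_mem_of_closure (by omega) h2
        ((lcsWeight_antitone (by omega)).trans hT) h4 (lyndonElt_mem x _) ?_
      rintro _ ⟨w, ⟨hw1, hw2, hw3⟩, rfl⟩
      refine ⟨?_, hind w _ hw1 hlr (by omega) hw3 hstd⟩
      rw [← hw2]
      exact lyndonElt_mem x w
    · have h4 := ihp _ (by omega) v _ hlr hv hstd rfl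
      rw [commutator_mem_comm]
      refine commutator_mem_of_closure (by omega) h3
        ((lcsWeight_antitone (by omega)).trans hT) h4 (lyndonElt_mem x _) ?_
      rintro _ ⟨w, ⟨hw1, hw2, hw3⟩, rfl⟩
      refine ⟨?_, hind w _ hw1 hll (by omega) hw3 hlv⟩
      rw [← hw2]
      exact lyndonElt_mem x w

/-- In a group generated by the elements `x a`, the elements of weight `n` are products of Lyndon
commutators of weight `n`, modulo elements of weight `n + 1`. -/
theorem lcsWeight_le_closure_lyndonElt [Finite α] (x : α → G)
    (hx : Subgroup.closure (Set.range x) = ⊤) {n : ℕ} (hn : 1 ≤ n) :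
    lcsWeight G n ≤
      Subgroup.closure (lyndonElt x '' {w | IsLyndon w ∧ w.length = n}) ⊔ lcsWeight G (n + 1) := by
  induction n, hn using Nat.le_induction with
  | base =>
    have h : Set.range x ⊆ lyndonElt x '' {w | IsLyndon w ∧ w.length = 1} := by
      rintro _ ⟨a, rfl⟩
      exact ⟨[a], ⟨isLyndon_singleton a, rfl⟩, lyndonElt_singleton x a⟩
    exact le_sup_of_le_left (le_top.trans (hx.symm.le.trans (Subgroup.closure_mono h)))
  | succ n hn ih =>
    obtain ⟨m, rfl⟩ : ∃ m, n = m + 1 := ⟨n - 1, by omega⟩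
    set T := Subgroup.closure (lyndonElt x '' {w | IsLyndon w ∧ w.length = m + 1 + 1}) ⊔
      lcsWeight G (m + 1 + 1 + 1) with hT
    have hle : ∀ v, lyndonSpanLT x (m + 1 + 1) v ≤ T := by
      intro v
      refine sup_le_sup_right (Subgroup.closure_mono (Set.image_mono ?_)) _
      rintro w ⟨h1, h2, -⟩
      exact ⟨h1, h2⟩
    have hTW : lcsWeight G (m + 1 + 1 + 1) ≤ T := le_sup_right
    change ⁅lcsWeight G (m + 1), (⊤ : Subgroup G)⁆ ≤ T
    rw [Subgroup.commutator_le]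
    intro a ha b hb
    refine commutator_mem_of_closure hn le_rfl hTW (ih ha) hb ?_
    rintro _ ⟨w, ⟨hw1, hw2⟩, rfl⟩
    have hwm := lyndonElt_mem x w
    rw [hw2] at hwm
    refine ⟨hwm, ?_⟩
    rw [commutator_mem_comm]
    have hb' : b ∈ Subgroup.closure (Set.range x) ⊔ lcsWeight G (1 + 1) := by
      rw [hx]
      exact Subgroup.mem_sup_left (Subgroup.mem_top _)
    refine commutator_mem_of_closure le_rfl hn ((lcsWeight_antitone (by omega)).trans hTW) hb'
      hwm ?_
    rintro _ ⟨i, rfl⟩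
    refine ⟨Subgroup.mem_top _, ?_⟩
    rw [← lyndonElt_singleton x i]
    rcases lt_trichotomy [i] w with h | h | h
    · exact hle _ (commutator_lyndonElt_mem x _ w [i] (isLyndon_singleton i) hw1 h
        (by simp [hw2, add_comm]))
    · rw [h, commutatorElement_self]
      exact one_mem _
    · rw [commutator_mem_comm]
      exact hle _ (commutator_lyndonElt_mem x _ [i] w hw1 (isLyndon_singleton i) h
        (by simp [hw2]))

end LowerCentral

/-! ### Leading terms of the Magnus expansion and Magnus's theorem -/

section Magnus

variable {q k : ℕ}

theorem Word.length_take_add_drop (L : Word q k) (i : ℕ) : (L.take i).1 ++ (L.drop i).1 = L.1 :=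
  List.take_append_drop i L.1

theorem TruncAlg.one_apply_of_ne_nil {L : Word q k} (hL : L.1 ≠ []) :
    (1 : TruncAlg ℝ q k) L = 0 := by
  rw [one_apply, if_neg hL]

theorem TruncAlg.mul_apply_of_orderGE {m n : ℕ} {f g : TruncAlg ℝ q k} (hf : OrderGE m f)
    (hg : OrderGE n g) {L : Word q k} (hL : L.1.length = m + n) :
    (f * g) L = f (L.take m) * g (L.drop m) := by
  rw [mul_apply]
  refine Finset.sum_eq_single m (fun i hi him => ?_) fun h => ?_
  · rw [Finset.mem_range] at hi
    rcases lt_or_gt_of_ne him with h | h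
    · rw [hf _ (lt_of_le_of_lt (by simp [Word.take]) h), zero_mul]
    · rw [hg _ (by simp [Word.drop]; omega), mul_zero]
  · exact absurd (Finset.mem_range.mpr (by omega)) h

theorem orderGE_magnus_sub_one_of_mem {n : ℕ} (hn : 1 ≤ n) {x : FreeGroup (Fin q)}
    (hx : x ∈ lcsWeight (FreeGroup (Fin q)) n) :
    OrderGE n ((magnus ℝ q k x : TruncAlg ℝ q k) - 1) := by
  have h : OrderGE (n - 1 + 1) ((magnus ℝ q k x : TruncAlg ℝ q k) - 1) :=
    lowerCentralSeries_le_comap_magnus ℝ q k (n - 1) hx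
  rwa [Nat.sub_add_cancel hn] at h

theorem magnus_sub_one_apply {x : FreeGroup (Fin q)} {L : Word q k} (hL : L.1 ≠ []) :
    ((magnus ℝ q k x : TruncAlg ℝ q k) - 1) L = (magnus ℝ q k x : TruncAlg ℝ q k) L := by
  rw [TruncAlg.sub_apply, one_apply_of_ne_nil hL, sub_zero]

theorem Word.ne_nil_of_length {n : ℕ} (hn : 1 ≤ n) {L : Word q k} (hL : L.1.length = n) :
    L.1 ≠ [] := by
  intro h
  rw [h] at hL
  simp at hL
  omega

theorem magnus_apply_eq_zero {n : ℕ} {x : FreeGroup (Fin q)}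
    (hx : x ∈ lcsWeight (FreeGroup (Fin q)) (n + 1)) {L : Word q k} (hL : L.1.length = n)
    (hn : 1 ≤ n) : (magnus ℝ q k x : TruncAlg ℝ q k) L = 0 := by
  rw [← magnus_sub_one_apply (Word.ne_nil_of_length hn hL)]
  exact orderGE_magnus_sub_one_of_mem (by omega) hx L (by omega)

/-- The degree `n` part of the Magnus expansion is additive on elements of weight `n`. -/
theorem magnus_mul_apply {n : ℕ} (hn : 1 ≤ n) {x y : FreeGroup (Fin q)}
    (hx : x ∈ lcsWeight (FreeGroup (Fin q)) n) (hy : y ∈ lcsWeight (FreeGroup (Fin q)) n)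
    {L : Word q k} (hL : L.1.length = n) :
    (magnus ℝ q k (x * y) : TruncAlg ℝ q k) L =
      (magnus ℝ q k x : TruncAlg ℝ q k) L + (magnus ℝ q k y : TruncAlg ℝ q k) L := by
  have hL0 := Word.ne_nil_of_length hn hL
  have h : (magnus ℝ q k (x * y) : TruncAlg ℝ q k) - 1 =
      ((magnus ℝ q k x : TruncAlg ℝ q k) - 1) * ((magnus ℝ q k y : TruncAlg ℝ q k) - 1) +
        ((magnus ℝ q k x : TruncAlg ℝ q k) - 1) + ((magnus ℝ q k y : TruncAlg ℝ q k) - 1) := by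
    rw [map_mul, Units.val_mul]
    noncomm_ring
  have h1 := (orderGE_magnus_sub_one_of_mem (k := k) hn hx).mul
    (orderGE_magnus_sub_one_of_mem (k := k) hn hy) L (by omega)
  rw [← magnus_sub_one_apply hL0, h, TruncAlg.add_apply, TruncAlg.add_apply, h1, zero_add,
    magnus_sub_one_apply hL0, magnus_sub_one_apply hL0]

/-- The degree `n` part of the Magnus expansion, as a homomorphism on the elements of
weight `n`. -/
noncomputable def leadingPart (q k : ℕ) {n : ℕ} (hn : 1 ≤ n) :
    lcsWeight (FreeGroup (Fin q)) n →*
      Multiplicative ({L : Word q k // L.1.length = n} → ℝ) where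
  toFun x := Multiplicative.ofAdd fun L => (magnus ℝ q k x.1 : TruncAlg ℝ q k) L.1
  map_one' := by
    rw [← ofAdd_zero, EmbeddingLike.apply_eq_iff_eq]
    funext L
    simp [one_apply, Word.ne_nil_of_length hn L.2]
  map_mul' x y := by
    rw [← ofAdd_add, EmbeddingLike.apply_eq_iff_eq]
    funext L
    exact magnus_mul_apply hn x.2 y.2 L.2

theorem leadingPart_apply {n : ℕ} (hn : 1 ≤ n) (x : lcsWeight (FreeGroup (Fin q)) n)
    (L : {L : Word q k // L.1.length = n}) :
    (leadingPart q k hn x).toAdd L = (magnus ℝ q k x.1 : TruncAlg ℝ q k) L.1 := rfl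

open scoped commutatorElement in
/-- The leading part of a commutator is the commutator of the leading parts. -/
theorem magnus_commutator_apply {m n : ℕ} (hm : 1 ≤ m) (hn : 1 ≤ n) {x y : FreeGroup (Fin q)}
    (hx : x ∈ lcsWeight (FreeGroup (Fin q)) m) (hy : y ∈ lcsWeight (FreeGroup (Fin q)) n)
    {L : Word q k} (hL : L.1.length = m + n) :
    (magnus ℝ q k ⁅x, y⁆ : TruncAlg ℝ q k) L =
      (magnus ℝ q k x : TruncAlg ℝ q k) (L.take m) * (magnus ℝ q k y : TruncAlg ℝ q k) (L.drop m) -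
      (magnus ℝ q k y : TruncAlg ℝ q k) (L.take n) *
        (magnus ℝ q k x : TruncAlg ℝ q k) (L.drop n) := by
  have hX := orderGE_magnus_sub_one_of_mem (k := k) hm hx
  have hY := orderGE_magnus_sub_one_of_mem (k := k) hn hy
  set X := (magnus ℝ q k x : TruncAlg ℝ q k) - 1 with hXdef
  set Y := (magnus ℝ q k y : TruncAlg ℝ q k) - 1 with hYdef
  have hXY : OrderGE (m + n) (X * Y - Y * X) := by
    refine (hX.mul hY).sub ?_
    rw [add_comm]
    exact hY.mul hX
  have key : (magnus ℝ q k ⁅x, y⁆ : TruncAlg ℝ q k) - 1 = (X * Y - Y * X) +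
      (X * Y - Y * X) * ((magnus ℝ q k (x⁻¹ * y⁻¹) : TruncAlg ℝ q k) - 1) := by
    have h1 : X * Y - Y * X = (magnus ℝ q k (x * y) : TruncAlg ℝ q k) -
        (magnus ℝ q k (y * x) : TruncAlg ℝ q k) := by
      rw [hXdef, hYdef, map_mul, map_mul, Units.val_mul, Units.val_mul]
      noncomm_ring
    have h2 : (X * Y - Y * X) * (magnus ℝ q k (x⁻¹ * y⁻¹) : TruncAlg ℝ q k) =
        (magnus ℝ q k ⁅x, y⁆ : TruncAlg ℝ q k) - 1 := by
      rw [h1, sub_mul, ← Units.val_mul, ← Units.val_mul, ← map_mul, ← map_mul]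
      have h3 : y * x * (x⁻¹ * y⁻¹) = 1 := by group
      have h4 : x * y * (x⁻¹ * y⁻¹) = ⁅x, y⁆ := by
        rw [commutatorElement_def]
        group
      rw [h3, h4, map_one, Units.val_one]
    rw [mul_sub (X * Y - Y * X), mul_one, h2]
    abel
  have hL0 : L.1 ≠ [] := Word.ne_nil_of_length (by omega) hL
  have h5 := hXY.mul (orderGE_magnus_sub_one ℝ q k (x⁻¹ * y⁻¹)) L (by omega)
  have t1 : (L.take m).1 ≠ [] := Word.ne_nil_of_length hm (by simp [Word.take]; omega)
  have t2 : (L.drop m).1 ≠ [] := Word.ne_nil_of_length hn (by simp [Word.drop]; omega)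
  have t3 : (L.take n).1 ≠ [] := Word.ne_nil_of_length hn (by simp [Word.take]; omega)
  have t4 : (L.drop n).1 ≠ [] := Word.ne_nil_of_length hm (by simp [Word.drop]; omega)
  rw [← magnus_sub_one_apply hL0, key, TruncAlg.add_apply, h5, add_zero, TruncAlg.sub_apply,
    mul_apply_of_orderGE hX hY hL, mul_apply_of_orderGE hY hX (by omega), hXdef, hYdef,
    magnus_sub_one_apply t1, magnus_sub_one_apply t2, magnus_sub_one_apply t3,
    magnus_sub_one_apply t4]

/-- The leading part of a Lyndon commutator is the Lyndon word plus a combination of larger words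
of the same length. -/
theorem magnus_lyndonElt_apply {w : List (Fin q)} (hw : IsLyndon w) {L : Word q k}
    (hL : L.1.length = w.length) (hLw : L.1 ≤ w) :
    (magnus ℝ q k (lyndonElt FreeGroup.of w) : TruncAlg ℝ q k) L = if L.1 = w then 1 else 0 := by
  induction hn : w.length using Nat.strong_induction_on generalizing w L with
  | _ n ih =>
  by_cases h : 2 ≤ w.length
  · have h1 := length_leftFactor_add h
    have h2 := length_rightFactor_pos h
    have h3 := length_leftFactor_pos h
    have hl := hw.leftFactor h
    have hr := IsLyndon.rightFactor h
    have hlr := hw.leftFactor_lt_rightFactor h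
    have hfac := (factor_spec h).1
    set u := leftFactor w
    set v := rightFactor w
    have hwv : w < v := by
      conv_lhs => rw [hfac]
      exact hr.append_lt_right hlr hl.1
    have hsum : L.1.length = u.length + v.length := by omega
    rw [lyndonElt_of_two_le _ h, magnus_commutator_apply h3 h2 (lyndonElt_mem _ _)
      (lyndonElt_mem _ _) hsum]
    have e1 := L.length_take_add_drop u.length
    have e2 := L.length_take_add_drop v.length
    have l1 : (L.take u.length).1.length = u.length := by simp [Word.take]; omega
    have l2 : (L.drop u.length).1.length = v.length := by simp [Word.drop]; omega
    have l3 : (L.take v.length).1.length = v.length := by simp [Word.take]; omega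
    have l4 : (L.drop v.length).1.length = u.length := by simp [Word.drop]; omega
    -- the second term of the commutator vanishes at `L`: a prefix of `L` of length `|v|` that is at
    -- least `v` would be larger than `w`, as `w < v`
    have z1 : (magnus ℝ q k (lyndonElt FreeGroup.of v) : TruncAlg ℝ q k) (L.take v.length) = 0 := by
      have hlt : (L.take v.length).1 < v := by
        by_contra hcon
        have h4 := List.append_lt_append_of_length_le (hwv.trans_le (not_lt.mp hcon)) (by omega)
          [] (L.drop v.length).1
        rw [e2, List.append_nil] at h4
        exact absurd h4 (not_lt.mpr hLw)
      rw [ih _ (by omega) hr l3 hlt.le rfl, if_neg hlt.ne]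
    rw [z1, zero_mul, sub_zero]
    have hle : (L.take u.length).1 ≤ u := by
      by_contra hcon
      have h4 := List.append_lt_append_of_length_le (not_le.mp hcon) (by omega)
          v (L.drop u.length).1
      rw [e1, ← hfac] at h4
      exact absurd h4 (not_lt.mpr hLw)
    rw [ih _ (by omega) hl l1 hle rfl]
    by_cases heq : (L.take u.length).1 = u
    · have hle2 : (L.drop u.length).1 ≤ v := by
        rw [← e1, heq, hfac] at hLw
        by_contra hcon
        exact absurd hLw (not_le.mpr (List.append_lt_append_left_iff.mpr (not_le.mp hcon)))
      rw [ih _ (by omega) hr l2 hle2 rfl, if_pos heq, one_mul]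
      refine if_congr ?_ rfl rfl
      rw [← e1, heq]
      conv_rhs => rw [hfac]
      exact List.append_right_inj _ |>.symm
    · rw [if_neg heq, zero_mul, if_neg]
      intro hLw'
      refine heq ?_
      change L.1.take u.length = u
      rw [hLw', hfac, List.take_left]
  · have hw0 := List.length_pos_iff.mpr hw.1
    obtain ⟨a, rfl⟩ := List.length_eq_one_iff.mp (by omega : w.length = 1)
    rw [lyndonElt_singleton, ← magnus_sub_one_apply (Word.ne_nil_of_length le_rfl hL)]
    have h : (magnus ℝ q k (FreeGroup.of a) : TruncAlg ℝ q k) - 1 = X a := by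
      simp [magnus, oneAddX]
    rw [h]
    rfl

/-- An element of weight `n` whose Magnus expansion has no terms of degree `n` has weight `n + 1`:
writing it as a product of Lyndon commutators, the exponents are recovered one after the other from
the coefficients of the Lyndon words. -/
theorem mem_lcsWeight_succ_of_magnus {n : ℕ} (hn : 1 ≤ n) (hnk : n < k) {x : FreeGroup (Fin q)}
    (hx : x ∈ lcsWeight (FreeGroup (Fin q)) n)
    (h0 : ∀ L : Word q k, L.1.length = n → (magnus ℝ q k x : TruncAlg ℝ q k) L = 0) :
    x ∈ lcsWeight (FreeGroup (Fin q)) (n + 1) := by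
  classical
  have key : ∀ S : Finset (List (Fin q)), (∀ w ∈ S, IsLyndon w ∧ w.length = n) →
      ∀ x ∈ Subgroup.closure (lyndonElt FreeGroup.of '' (S : Set (List (Fin q)))) ⊔
        lcsWeight (FreeGroup (Fin q)) (n + 1),
      (∀ L : Word q k, L.1.length = n → (magnus ℝ q k x : TruncAlg ℝ q k) L = 0) →
      x ∈ lcsWeight (FreeGroup (Fin q)) (n + 1) := by
    intro S
    induction S using Finset.induction_on_min with
    | empty =>
      intro _ x hx _
      simpa using hx
    | insert a s has ih =>
      intro hS x hx hx0
      have ha := hS a (Finset.mem_insert_self a s)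
      have hs : ∀ w ∈ s, IsLyndon w ∧ w.length = n := fun w hw => hS w (Finset.mem_insert_of_mem hw)
      set H := Subgroup.closure (lyndonElt FreeGroup.of '' (s : Set (List (Fin q)))) ⊔
        lcsWeight (FreeGroup (Fin q)) (n + 1) with hH
      have hHn : H ≤ lcsWeight (FreeGroup (Fin q)) n := by
        refine sup_le ((Subgroup.closure_le _).mpr ?_) (lcsWeight_antitone (Nat.le_succ n))
        rintro _ ⟨w, hw, rfl⟩
        have := lyndonElt_mem (FreeGroup.of) w
        rwa [(hs w hw).2] at this
      have hnormal : H.Normal := by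
        refine ⟨fun h hh g => ?_⟩
        have e : g * h * g⁻¹ = g * h * g⁻¹ * h⁻¹ * h := by group
        rw [e]
        refine mul_mem ((le_sup_right : _ ≤ H) ?_) hh
        exact commutator_mem_lcsWeight le_rfl hn (by omega) (Subgroup.mem_top g) (hHn hh)
      have hga : lyndonElt FreeGroup.of a ∈ lcsWeight (FreeGroup (Fin q)) n := by
        have := lyndonElt_mem (FreeGroup.of) a
        rwa [ha.2] at this
      rw [Finset.coe_insert, Set.image_insert_eq, Set.insert_eq, Subgroup.closure_union,
        ← Subgroup.zpowers_eq_closure, sup_assoc] at hx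
      obtain ⟨g, hg, h, hh, rfl⟩ := Subgroup.mem_sup_of_normal_right.mp hx
      obtain ⟨m, rfl⟩ := Subgroup.mem_zpowers_iff.mp hg
      -- the coefficient of the smallest word
      let La : Word q k := ⟨a, by omega⟩
      have hHa : ∀ h ∈ H, (magnus ℝ q k h : TruncAlg ℝ q k) La = 0 := by
        intro h hh
        have hle : H ≤ ((Pi.evalAddMonoidHom (fun _ : {L : Word q k // L.1.length = n} => ℝ)
            ⟨La, ha.2⟩).toMultiplicative.comp (leadingPart q k hn)).ker.map
              (lcsWeight (FreeGroup (Fin q)) n).subtype := by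
          refine sup_le ((Subgroup.closure_le _).mpr ?_) ?_
          · rintro _ ⟨w, hw, rfl⟩
            have hgw := lyndonElt_mem (FreeGroup.of) w
            rw [(hs w hw).2] at hgw
            refine ⟨⟨_, hgw⟩, ?_, rfl⟩
            change (magnus ℝ q k (lyndonElt FreeGroup.of w) : TruncAlg ℝ q k) La = 0
            rw [magnus_lyndonElt_apply (hs w hw).1 (ha.2.trans (hs w hw).2.symm) (has w hw).le,
              if_neg (has w hw).ne]
          · intro y hy
            refine ⟨⟨y, lcsWeight_antitone (Nat.le_succ n) hy⟩, ?_, rfl⟩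
            exact magnus_apply_eq_zero hy ha.2 hn
        obtain ⟨y, hy, rfl⟩ := hle hh
        exact hy
      have hm : ((m : ℤ) : ℝ) = 0 := by
        have e1 := hx0 La ha.2
        rw [magnus_mul_apply hn (zpow_mem hga m) (hHn hh) ha.2, hHa h hh, add_zero] at e1
        have e2 := congrArg (fun f => f.toAdd ⟨La, ha.2⟩)
          (map_zpow (leadingPart q k hn) ⟨_, hga⟩ m)
        simp only [toAdd_zpow, Pi.smul_apply, leadingPart_apply] at e2
        rw [magnus_lyndonElt_apply ha.1 rfl le_rfl, if_pos rfl] at e2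
        simpa using e2.symm.trans e1
      have hm0 : m = 0 := by exact_mod_cast hm
      subst hm0
      rw [zpow_zero, one_mul] at hx0 ⊢
      exact ih hs h hh hx0
  have hfin : {w : List (Fin q) | IsLyndon w ∧ w.length = n}.Finite :=
    (List.finite_length_eq (Fin q) n).subset fun w hw => hw.2
  have hx' := lcsWeight_le_closure_lyndonElt FreeGroup.of (FreeGroup.closure_range_of _) hn hx
  refine key hfin.toFinset (fun w hw => by simpa using hw) x ?_ h0
  simpa using hx'

/-- Magnus's theorem: the kernel of the Magnus expansion modulo degree `k` is the `k`-th term of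
the lower central series. -/
theorem magnusBar_injective (hk : 1 ≤ k) : Function.Injective (magnusBar ℝ q k) := by
  rw [injective_iff_map_eq_one]
  intro g
  induction g using QuotientGroup.induction_on with
  | H x =>
    intro hx
    have hx' : magnus ℝ q k x = 1 := hx
    rw [QuotientGroup.eq_one_iff]
    have : ∀ n, n < k → x ∈ lcsWeight (FreeGroup (Fin q)) (n + 1) := by
      intro n
      induction n with
      | zero => exact fun _ => Subgroup.mem_top x
      | succ n ih =>
        intro hn
        refine mem_lcsWeight_succ_of_magnus (k := k) (by omega) hn (ih (by omega)) fun L hL => ?_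
        rw [hx', Units.val_one, one_apply_of_ne_nil (Word.ne_nil_of_length (by omega) hL)]
    have h := this (k - 1) (by omega)
    exact h

end Magnus

/-! ### Counting shuffles with overlaps -/

section Infiltration

variable {α : Type*} [DecidableEq α]

/-- The value of `f` at the tail of `J` if `J` starts with the letter `c`, and `0` otherwise. -/
def headMatch (c : α) (J : List α) (f : List α → ℕ) : ℕ :=
  match J with
  | [] => 0
  | a :: J' => if a = c then f J' else 0

/-- The number of ways in which `L` is a resulting shuffle of `J` and `K`, by recursion on `L`:
the first letter of `L` is the first letter of `J`, or of `K`, or of both. -/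
def infil : List α → List α → List α → ℕ
  | [], J, K => if J = [] ∧ K = [] then 1 else 0
  | c :: L, J, K =>
    headMatch c J (fun J' => infil L J' K) + headMatch c K (fun K' => infil L J K') +
      headMatch c J fun J' => headMatch c K fun K' => infil L J' K'

theorem headMatch_mul (c : α) (J : List α) (f : List α → ℕ) (x : ℕ) :
    headMatch c J f * x = headMatch c J fun J' => f J' * x := by
  cases J with
  | nil => exact zero_mul x
  | cons a J => simp only [headMatch, ite_mul, zero_mul]

theorem headMatch_sum {ι : Type*} (s : Finset ι) (c : α) (J : List α) (f : ι → List α → ℕ) :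
    ∑ i ∈ s, headMatch c J (f i) = headMatch c J fun J' => ∑ i ∈ s, f i J' := by
  cases J with
  | nil => simp [headMatch]
  | cons a J =>
    simp only [headMatch]
    split_ifs <;> simp

theorem sum_headMatch_take (c : α) (J : List α) (F : List α → List α → ℕ) :
    ∑ i ∈ Finset.range (J.length + 1), headMatch c (J.take i) (fun J' => F J' (J.drop i)) =
      headMatch c J fun J' => ∑ i ∈ Finset.range (J'.length + 1), F (J'.take i) (J'.drop i) := by
  cases J with
  | nil => simp [headMatch]
  | cons a J =>
    rw [Finset.sum_range_succ']
    simp only [headMatch, List.length_cons, List.take_succ_cons, List.drop_succ_cons,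
      List.take_zero, add_zero]
    split_ifs <;> simp

/-- A shuffle which is a concatenation `L₁ L₂` consists of a shuffle of prefixes of `J` and `K` and
a shuffle of the complementary suffixes. -/
theorem infil_append (L₁ L₂ J K : List α) :
    infil (L₁ ++ L₂) J K = ∑ i ∈ Finset.range (J.length + 1), ∑ j ∈ Finset.range (K.length + 1),
      infil L₁ (J.take i) (K.take j) * infil L₂ (J.drop i) (K.drop j) := by
  induction L₁ generalizing J K with
  | nil =>
    rw [Finset.sum_eq_single 0, Finset.sum_eq_single 0]
    · simp [infil]
    · intro j hj hj0
      have : K ≠ [] := by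
        rintro rfl
        simp at hj
        exact hj0 hj
      simp [infil, hj0, this]
    · simp
    · intro i hi hi0
      have : J ≠ [] := by
        rintro rfl
        simp at hi
        exact hi0 hi
      simp [infil, hi0, this]
    · simp
  | cons c L₁ ih =>
    simp only [List.cons_append, infil, ih, add_mul, Finset.sum_add_distrib, headMatch_mul]
    congr 1
    · congr 1
      · simp only [headMatch_sum]
        rw [sum_headMatch_take c J fun J₁ J₂ => ∑ j ∈ Finset.range (K.length + 1),
          infil L₁ J₁ (K.take j) * infil L₂ J₂ (K.drop j)]
      · rw [← headMatch_sum]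
        refine Finset.sum_congr rfl fun i _ => ?_
        rw [sum_headMatch_take c K fun K₁ K₂ => infil L₁ (J.take i) K₁ * infil L₂ (J.drop i) K₂]
    · simp only [headMatch_sum]
      rw [sum_headMatch_take c J fun J₁ J₂ => ∑ j ∈ Finset.range (K.length + 1),
        headMatch c (K.take j) fun K₁ => infil L₁ J₁ K₁ * infil L₂ J₂ (K.drop j)]
      congr 1
      funext J'
      rw [← headMatch_sum]
      refine Finset.sum_congr rfl fun i _ => ?_
      rw [sum_headMatch_take c K fun K₁ K₂ => infil L₁ (J'.take i) K₁ * infil L₂ (J'.drop i) K₂]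

theorem headMatch_eq_zero {c : α} {J : List α} {f : List α → ℕ}
    (h : ∀ J', J = c :: J' → f J' = 0) : headMatch c J f = 0 := by
  cases J with
  | nil => rfl
  | cons a J =>
    simp only [headMatch]
    split_ifs with hac
    · exact h J (by rw [hac])
    · rfl

theorem infil_eq_zero_of_length {L J K : List α} (h : J.length + K.length < L.length) :
    infil L J K = 0 := by
  induction L generalizing J K with
  | nil => simp at h
  | cons c L ih =>
    have h1 : ∀ J', J = c :: J' → infil L J' K = 0 := by
      rintro J' rfl
      simp only [List.length_cons] at h
      exact ih (by omega)
    have h2 : ∀ K', K = c :: K' → infil L J K' = 0 := by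
      rintro K' rfl
      simp only [List.length_cons] at h
      exact ih (by omega)
    have h3 : ∀ J', J = c :: J' → headMatch c K (fun K' => infil L J' K') = 0 := by
      rintro J' rfl
      refine headMatch_eq_zero ?_
      rintro K' rfl
      simp only [List.length_cons] at h
      exact ih (by omega)
    rw [infil, headMatch_eq_zero h1, headMatch_eq_zero h2, headMatch_eq_zero h3]

end Infiltration

/-! ### Positions of the letters in a shuffle -/

section Reading

variable {α : Type*}

/-- The strictly increasing sequences of positions at which the word `J` is read off in `L`. -/
abbrev Reading (J L : List α) : Type :=
  {f : Fin J.length ↪o Fin L.length // ∀ i, L.get (f i) = J.get i}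

namespace Reading

variable {J K L : List α} {c : α}

/-- The positions in `c :: L` of a word that is read off in `L`. -/
def lift (c : α) (f : Reading J L) : Reading J (c :: L) :=
  ⟨f.1.trans (Fin.succOrderEmb L.length), fun i => f.2 i⟩

/-- The positions in `c :: L` of the word `c :: J'`, where `J'` is read off in `L`. -/
def cons (c : α) {J' : List α} (h : J = c :: J') (f : Reading J' L) : Reading J (c :: L) := by
  subst h
  refine ⟨OrderEmbedding.ofStrictMono (Fin.cons 0 fun i => (f.1 i).succ) ?_, ?_⟩
  · intro i j hij
    refine Fin.cases (fun h => ?_) (fun i h => ?_) i hij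
    · refine Fin.cases (fun h => absurd h (lt_irrefl _)) (fun j _ => ?_) j h
      exact Fin.succ_pos _
    · refine Fin.cases (fun h => absurd h (Fin.not_lt_zero _)) (fun j h => ?_) j h
      exact Fin.succ_lt_succ_iff.mpr (f.1.strictMono (Fin.succ_lt_succ_iff.mp h))
  · intro i
    refine Fin.cases rfl (fun i => ?_) i
    exact f.2 i

theorem lift_ne_zero (f : Reading J L) (i : Fin J.length) : (lift c f).1 i ≠ 0 :=
  Fin.succ_ne_zero _

theorem exists_lift_eq_succ (f : Reading J L) (s : Fin L.length) :
    (∃ i, (lift c f).1 i = Fin.succ s) ↔ ∃ i, f.1 i = s := by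
  refine exists_congr fun i => ?_
  exact Fin.succ_inj

theorem exists_cons_eq_zero {J' : List α} (h : J = c :: J') (f : Reading J' L) :
    ∃ i, (cons c h f).1 i = 0 := by
  subst h
  exact ⟨0, rfl⟩

theorem exists_cons_eq_succ {J' : List α} (h : J = c :: J') (f : Reading J' L) (s : Fin L.length) :
    (∃ i, (cons c h f).1 i = Fin.succ s) ↔ ∃ i, f.1 i = s := by
  subst h
  constructor
  · rintro ⟨i, hi⟩
    revert hi
    refine Fin.cases (fun hi => ?_) (fun i hi => ⟨i, ?_⟩) i
    · exact absurd hi.symm (Fin.succ_ne_zero s)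
    · exact Fin.succ_inj.mp hi
  · rintro ⟨i, hi⟩
    exact ⟨Fin.succ i, Fin.succ_inj.mpr hi⟩

theorem lift_injective : Function.Injective (lift c : Reading J L → Reading J (c :: L)) := by
  intro f g h
  refine Subtype.ext (RelEmbedding.ext fun i => ?_)
  have := congrArg (fun e : Reading J (c :: L) => e.1 i) h
  exact Fin.succ_inj.mp this

theorem cons_injective {J' : List α} (h : J = c :: J') :
    Function.Injective (cons c h : Reading J' L → Reading J (c :: L)) := by
  subst h
  intro f g h
  refine Subtype.ext (RelEmbedding.ext fun i => ?_)
  have := congrArg (fun e : Reading (c :: J') (c :: L) => e.1 i.succ) h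
  exact Fin.succ_inj.mp this

theorem eq_lift_or_eq_cons (f : Reading J (c :: L)) :
    (∃ g : Reading J L, f = lift c g) ∨
      ∃ (J' : List α) (h : J = c :: J') (g : Reading J' L), f = cons c h g := by
  by_cases h0 : ∀ i, f.1 i ≠ 0
  · left
    refine ⟨⟨OrderEmbedding.ofStrictMono (fun i => (f.1 i).pred (h0 i)) fun i j hij =>
      Fin.pred_lt_pred_iff.mpr (f.1.strictMono hij), fun i => ?_⟩, ?_⟩
    · rw [← f.2 i]
      change L.get ((f.1 i).pred (h0 i)) = (c :: L).get (f.1 i)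
      conv_rhs => rw [← Fin.succ_pred (f.1 i) (h0 i)]
      rfl
    · exact Subtype.ext (RelEmbedding.ext fun i => (Fin.succ_pred _ (h0 i)).symm)
  · right
    push Not at h0
    obtain ⟨i, hi⟩ := h0
    cases J with
    | nil => exact i.elim0
    | cons a J' =>
      have h0 : f.1 (0 : Fin (J'.length + 1)) = 0 := by
        refine le_antisymm ?_ (Fin.zero_le _)
        rw [← hi]
        exact f.1.monotone (Fin.zero_le i)
      have hac : a = c := by
        have := f.2 (0 : Fin (J'.length + 1))
        rw [h0] at this
        exact this.symm
      subst hac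
      have hs : ∀ i : Fin J'.length, f.1 (Fin.succ i) ≠ 0 := fun i h => by
        rw [← h0] at h
        exact Fin.succ_ne_zero i (f.1.injective h)
      refine ⟨J', rfl, ⟨OrderEmbedding.ofStrictMono (fun i => (f.1 (Fin.succ i)).pred (hs i))
        fun i j hij => Fin.pred_lt_pred_iff.mpr (f.1.strictMono (Fin.succ_lt_succ_iff.mpr hij)),
        fun i => ?_⟩, ?_⟩
      · have h1 := f.2 (Fin.succ i)
        change L.get ((f.1 (Fin.succ i)).pred (hs i)) = (a :: J').get (Fin.succ i)
        rw [← h1]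
        conv_rhs => rw [← Fin.succ_pred (f.1 (Fin.succ i)) (hs i)]
        rfl
      · refine Subtype.ext (RelEmbedding.ext fun i => ?_)
        refine Fin.cases h0 (fun i => ?_) i
        exact (Fin.succ_pred _ (hs i)).symm

end Reading

theorem Reading.cons_ne_lift {J L J' : List α} {c : α} (h : J = c :: J') (f : Reading J' L)
    (g : Reading J L) : f.cons c h ≠ g.lift c := by
  intro e
  obtain ⟨i, hi⟩ := f.exists_cons_eq_zero h
  rw [e] at hi
  exact g.lift_ne_zero i hi

/-- The pairs of sequences of positions that exhibit `L` as a resulting shuffle of `J` and `K`. -/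
abbrev ShufflePair (J K L : List α) : Type :=
  {p : Reading J L × Reading K L // ∀ s, (∃ i, p.1.1 i = s) ∨ ∃ j, p.2.1 j = s}

theorem forall_cons_iff {c : α} {L : List α} {P : Fin (c :: L).length → Prop} :
    (∀ s, P s) ↔ P (0 : Fin (L.length + 1)) ∧ ∀ s : Fin L.length, P (Fin.succ s) :=
  Fin.forall_fin_succ

/-- A shuffle in `c :: L` arises from a shuffle in `L` in exactly one of three ways. -/
def shufflePairCons (J K : List α) (c : α) (L : List α) :
    (Σ J' : {J' // J = c :: J'}, ShufflePair J'.1 K L) ⊕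
      (Σ K' : {K' // K = c :: K'}, ShufflePair J K'.1 L) ⊕
        (Σ J' : {J' // J = c :: J'}, Σ K' : {K' // K = c :: K'}, ShufflePair J'.1 K'.1 L) →
      ShufflePair J K (c :: L)
  | .inl ⟨J', p⟩ => ⟨(p.1.1.cons c J'.2, p.1.2.lift c), forall_cons_iff.mpr
      ⟨Or.inl (Reading.exists_cons_eq_zero J'.2 _), fun s => by
        rw [Reading.exists_cons_eq_succ, Reading.exists_lift_eq_succ]
        exact p.2 s⟩⟩
  | .inr (.inl ⟨K', p⟩) => ⟨(p.1.1.lift c, p.1.2.cons c K'.2), forall_cons_iff.mpr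
      ⟨Or.inr (Reading.exists_cons_eq_zero K'.2 _), fun s => by
        rw [Reading.exists_cons_eq_succ, Reading.exists_lift_eq_succ]
        exact p.2 s⟩⟩
  | .inr (.inr ⟨J', K', p⟩) => ⟨(p.1.1.cons c J'.2, p.1.2.cons c K'.2), forall_cons_iff.mpr
      ⟨Or.inl (Reading.exists_cons_eq_zero J'.2 _), fun s => by
        rw [Reading.exists_cons_eq_succ, Reading.exists_cons_eq_succ]
        exact p.2 s⟩⟩

theorem shufflePairCons_bijective (J K : List α) (c : α) (L : List α) :
    Function.Bijective (shufflePairCons J K c L) := by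
  constructor
  · have hJ : ∀ {J : List α} (x y : {J' // J = c :: J'}), x = y := fun x y =>
      Subtype.ext (List.cons.inj (x.2.symm.trans y.2)).2
    rintro (⟨J₁, p₁⟩ | ⟨K₁, p₁⟩ | ⟨J₁, K₁, p₁⟩) (⟨J₂, p₂⟩ | ⟨K₂, p₂⟩ | ⟨J₂, K₂, p₂⟩) h <;>
      obtain ⟨h1, h2⟩ := Prod.ext_iff.mp (congrArg Subtype.val h)
    · obtain rfl := hJ J₁ J₂
      rw [Subtype.ext (Prod.ext (Reading.cons_injective J₁.2 h1) (Reading.lift_injective h2))]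
    · exact absurd h1 (Reading.cons_ne_lift J₁.2 _ _)
    · exact absurd h2.symm (Reading.cons_ne_lift K₂.2 _ _)
    · exact absurd h1.symm (Reading.cons_ne_lift J₂.2 _ _)
    · obtain rfl := hJ K₁ K₂
      rw [Subtype.ext (Prod.ext (Reading.lift_injective h1) (Reading.cons_injective K₁.2 h2))]
    · exact absurd h1.symm (Reading.cons_ne_lift J₂.2 _ _)
    · exact absurd h2 (Reading.cons_ne_lift K₁.2 _ _)
    · exact absurd h1 (Reading.cons_ne_lift J₁.2 _ _)
    · obtain rfl := hJ J₁ J₂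
      obtain rfl := hJ K₁ K₂
      rw [Subtype.ext (Prod.ext (Reading.cons_injective J₁.2 h1) (Reading.cons_injective K₁.2 h2))]
  · rintro ⟨⟨f, g⟩, hfg⟩
    obtain ⟨h0, hs⟩ := forall_cons_iff.mp hfg
    rcases f.eq_lift_or_eq_cons with ⟨f', rfl⟩ | ⟨J', hJ', f', rfl⟩ <;>
      rcases g.eq_lift_or_eq_cons with ⟨g', rfl⟩ | ⟨K', hK', g', rfl⟩
    · rcases h0 with ⟨i, hi⟩ | ⟨i, hi⟩
      · exact absurd hi (Reading.lift_ne_zero _ _)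
      · exact absurd hi (Reading.lift_ne_zero _ _)
    · refine ⟨.inr (.inl ⟨⟨K', hK'⟩, ⟨(f', g'), fun s => ?_⟩⟩), rfl⟩
      have := hs s
      rwa [Reading.exists_cons_eq_succ, Reading.exists_lift_eq_succ] at this
    · refine ⟨.inl ⟨⟨J', hJ'⟩, ⟨(f', g'), fun s => ?_⟩⟩, rfl⟩
      have := hs s
      rwa [Reading.exists_cons_eq_succ, Reading.exists_lift_eq_succ] at this
    · refine ⟨.inr (.inr ⟨⟨J', hJ'⟩, ⟨K', hK'⟩, ⟨(f', g'), fun s => ?_⟩⟩), rfl⟩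
      have := hs s
      rwa [Reading.exists_cons_eq_succ, Reading.exists_cons_eq_succ] at this

theorem card_sigma_cons [DecidableEq α] (c : α) (J : List α) (T : List α → Type*)
    [∀ J', Finite (T J')] :
    Nat.card (Σ J' : {J' // J = c :: J'}, T J'.1) = headMatch c J fun J' => Nat.card (T J') := by
  cases J with
  | nil =>
    have : IsEmpty {J' : List α // [] = c :: J'} := ⟨fun x => by simpa using x.2⟩
    exact Nat.card_of_isEmpty
  | cons a J =>
    simp only [headMatch]
    split_ifs with hac
    · subst hac
      have : Unique {J' : List α // a :: J = a :: J'} :=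
        ⟨⟨⟨J, rfl⟩⟩, fun x => Subtype.ext (List.cons.inj x.2).2.symm⟩
      refine Nat.card_congr ((Equiv.uniqueSigma _).trans (Equiv.cast ?_))
      congr 1
      exact (List.cons.inj (default : {J' : List α // a :: J = a :: J'}).2).2.symm
    · have : IsEmpty {J' : List α // a :: J = c :: J'} := ⟨fun x => hac (List.cons.inj x.2).1⟩
      exact Nat.card_of_isEmpty

instance finite_subtype_eq_cons (c : α) (J : List α) : Finite {J' : List α // J = c :: J'} := by
  have : Subsingleton {J' : List α // J = c :: J'} :=
    ⟨fun x y => Subtype.ext (List.cons.inj (x.2.symm.trans y.2)).2⟩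
  infer_instance

instance finite_reading (J L : List α) : Finite (Reading J L) :=
  Finite.of_injective (fun f => (f.1 : Fin J.length → Fin L.length)) fun _ _ h =>
    Subtype.ext (DFunLike.coe_injective h)

theorem card_shufflePair [DecidableEq α] (J K L : List α) :
    Nat.card (ShufflePair J K L) = infil L J K := by
  induction L generalizing J K with
  | nil =>
    rw [infil]
    split_ifs with h
    · obtain ⟨rfl, rfl⟩ := h
      rw [Nat.card_eq_one_iff_unique]
      refine ⟨⟨fun x y => ?_⟩, ⟨⟨(⟨RelEmbedding.refl _, fun i => rfl⟩,
        ⟨RelEmbedding.refl _, fun i => rfl⟩), fun s => s.elim0⟩⟩⟩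
      refine Subtype.ext (Prod.ext (Subtype.ext (RelEmbedding.ext fun i => i.elim0))
        (Subtype.ext (RelEmbedding.ext fun i => i.elim0)))
    · have : IsEmpty (ShufflePair J K []) := by
        refine ⟨fun p => h ⟨?_, ?_⟩⟩
        · by_contra hJ
          exact (p.1.1.1 ⟨0, List.length_pos_iff.mpr hJ⟩).elim0
        · by_contra hK
          exact (p.1.2.1 ⟨0, List.length_pos_iff.mpr hK⟩).elim0
      exact Nat.card_of_isEmpty
  | cons c L ih =>
    rw [← Nat.card_congr (Equiv.ofBijective _ (shufflePairCons_bijective J K c L)), Nat.card_sum,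
      Nat.card_sum, card_sigma_cons c J fun J' => ShufflePair J' K L,
      card_sigma_cons c K fun K' => ShufflePair J K' L,
      card_sigma_cons c J fun J' => Σ K' : {K' // K = c :: K'}, ShufflePair J' K'.1 L]
    have h : ∀ J', Nat.card (Σ K' : {K' // K = c :: K'}, ShufflePair J' K'.1 L) =
        headMatch c K fun K' => Nat.card (ShufflePair J' K' L) := fun J' =>
      card_sigma_cons c K fun K' => ShufflePair J' K' L
    simp only [h, ih, infil, add_assoc]

end Reading

theorem shuffleCount_eq_infil {q : ℕ} (J K L : List (Fin q)) :
    shuffleCount J K L = infil L J K := by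
  rw [← card_shufflePair]
  refine Nat.card_congr
    { toFun := fun p => ⟨(⟨p.1.1, p.2.1⟩, ⟨p.1.2, p.2.2.1⟩), p.2.2.2⟩
      invFun := fun p => ⟨(p.1.1.1, p.1.2.1), p.1.1.2, p.1.2.2, p.2⟩
      left_inv := fun _ => rfl
      right_inv := fun _ => rfl }

/-! ### The shuffle relations are multiplicative -/

section GroupLike

variable {q k : ℕ}

/-- The linear form on the right hand side of the shuffle relation for `J` and `K`. -/
noncomputable def shuffleSum (a : TruncAlg ℝ q k) (J K : List (Fin q)) : ℝ :=
  ∑ L : Word q k, (infil L.1 J K : ℝ) * a L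

theorem mem_realMagnusImage_iff {a : TruncAlg ℝ q k} :
    a ∈ realMagnusImage q k ↔ (∀ w : Word q k, w.1 = [] → a w = 1) ∧
      ∀ J K : Word q k, J.1.length + K.1.length < k → a J * a K = shuffleSum a J.1 K.1 := by
  simp only [realMagnusImage, Set.mem_ofPred_eq, shuffleCount_eq_infil, shuffleSum]

theorem Word.length_take (L : Word q k) {i : ℕ} (h : i ≤ L.1.length) :
    (L.take i).1.length = i := by
  simp [Word.take, h]

theorem Word.length_drop (L : Word q k) (i : ℕ) : (L.drop i).1.length = L.1.length - i := by
  simp [Word.drop]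

/-- A linear form on a product, as a sum over the pairs of monomials of the factors. -/
theorem sum_mul_apply (a b : TruncAlg ℝ q k) (φ : List (Fin q) → ℝ)
    (hφ : ∀ L : List (Fin q), k ≤ L.length → φ L = 0) :
    ∑ L : Word q k, φ L.1 * (a * b) L =
      ∑ L₁ : Word q k, ∑ L₂ : Word q k, φ (L₁.1 ++ L₂.1) * (a L₁ * b L₂) := by
  classical
  simp only [mul_apply, Finset.mul_sum]
  rw [Finset.sum_sigma', ← Finset.sum_product', Finset.univ_product_univ]
  rw [← Finset.sum_filter_add_sum_filter_not Finset.univ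
    (fun p : Word q k × Word q k => p.1.1.length + p.2.1.length < k)]
  rw [Finset.sum_eq_zero (s := Finset.filter (fun p : Word q k × Word q k =>
    ¬ p.1.1.length + p.2.1.length < k) Finset.univ), add_zero]
  · refine Finset.sum_bij' (fun p _ => (p.1.take p.2, p.1.drop p.2))
      (fun p hp => ⟨⟨p.1.1 ++ p.2.1, ?_⟩, p.1.1.length⟩) ?_ ?_ ?_ ?_ ?_
    · have := (Finset.mem_filter.mp hp).2
      rwa [List.length_append]
    · rintro ⟨L, i⟩ h
      have hi : i < L.1.length + 1 := by simpa using h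
      have := L.2
      refine Finset.mem_filter.mpr ⟨Finset.mem_univ _, ?_⟩
      change (L.take i).1.length + (L.drop i).1.length < k
      rw [L.length_take (by omega), L.length_drop]
      omega
    · rintro ⟨L₁, L₂⟩ h
      simp
    · rintro ⟨L, i⟩ h
      have hi : i < L.1.length + 1 := by simpa using h
      refine Sigma.ext (Subtype.ext (L.length_take_add_drop i)) (heq_of_eq ?_)
      exact L.length_take (i := i) (by omega)
    · rintro ⟨L₁, L₂⟩ h
      exact Prod.ext (Subtype.ext List.take_left) (Subtype.ext List.drop_left)
    · rintro ⟨L, i⟩ h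
      simp only [L.length_take_add_drop i]
  · rintro ⟨L₁, L₂⟩ h
    have := (Finset.mem_filter.mp h).2
    rw [hφ _ (by rw [List.length_append]; simpa using this), zero_mul]

/-- The shuffles of `J` and `K` of length at least `k` are missing from `shuffleSum`; there are
none, since `|J| + |K| < k`. -/
theorem shuffleSum_mul (a b : TruncAlg ℝ q k) (J K : List (Fin q)) (h : J.length + K.length < k) :
    shuffleSum (a * b) J K =
      ∑ i ∈ Finset.range (J.length + 1), ∑ j ∈ Finset.range (K.length + 1),
        shuffleSum a (J.take i) (K.take j) * shuffleSum b (J.drop i) (K.drop j) := by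
  rw [shuffleSum, sum_mul_apply a b (fun L => (infil L J K : ℝ)) fun L hL => by
    rw [infil_eq_zero_of_length (by omega), Nat.cast_zero]]
  simp only [infil_append, shuffleSum, Finset.sum_mul_sum, Nat.cast_sum, Nat.cast_mul]
  simp only [Finset.sum_mul]
  rw [Finset.sum_congr rfl fun L₁ _ => Finset.sum_comm, Finset.sum_comm]
  refine Finset.sum_congr rfl fun i _ => ?_
  rw [Finset.sum_congr rfl fun L₁ _ => Finset.sum_comm, Finset.sum_comm]
  refine Finset.sum_congr rfl fun j _ => Finset.sum_congr rfl fun L₁ _ =>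
    Finset.sum_congr rfl fun L₂ _ => ?_
  ring

theorem one_mem_realMagnusImage : (1 : TruncAlg ℝ q k) ∈ realMagnusImage q k := by
  refine mem_realMagnusImage_iff.mpr ⟨fun w hw => by rw [one_apply, if_pos hw], fun J K h => ?_⟩
  have hk : 0 < k := by omega
  rw [shuffleSum, Finset.sum_eq_single ⟨[], hk⟩]
  · simp only [one_apply, infil, if_true, mul_one]
    by_cases hJ : J.1 = [] <;> by_cases hK : K.1 = [] <;> simp [hJ, hK]
  · intro L _ hL
    rw [one_apply_of_ne_nil fun h => hL (Subtype.ext h), mul_zero]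
  · simp

/-- Multiplying the shuffle relations for the prefixes of `J` and `K` with those for the
complementary suffixes, and summing, gives the shuffle relation for the product. -/
theorem mul_mem_realMagnusImage {a b : TruncAlg ℝ q k} (ha : a ∈ realMagnusImage q k)
    (hb : b ∈ realMagnusImage q k) : a * b ∈ realMagnusImage q k := by
  rw [mem_realMagnusImage_iff] at ha hb ⊢
  refine ⟨fun w hw => ?_, fun J K h => ?_⟩
  · have h1 : w.take 0 = w := Subtype.ext (by simp [Word.take, hw])
    have h2 : w.drop 0 = w := Subtype.ext (by simp [Word.drop])
    rw [mul_apply, hw]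
    simp [h1, h2, ha.1 w hw, hb.1 w hw]
  · rw [shuffleSum_mul a b J.1 K.1 h, mul_apply, mul_apply, Finset.sum_mul_sum]
    refine Finset.sum_congr rfl fun i hi => Finset.sum_congr rfl fun j hj => ?_
    have hi' : i ≤ J.1.length := by simpa [Nat.lt_succ_iff] using hi
    have hj' : j ≤ K.1.length := by simpa [Nat.lt_succ_iff] using hj
    have e1 := ha.2 (J.take i) (K.take j) (by
      rw [Word.length_take _ hi', Word.length_take _ hj']; omega)
    have e2 := hb.2 (J.drop i) (K.drop j) (by
      rw [Word.length_drop, Word.length_drop]; omega)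
    change _ = shuffleSum a (J.take i).1 (K.take j).1 * shuffleSum b (J.drop i).1 (K.drop j).1
    rw [← e1, ← e2]
    ring

theorem pow_mem_realMagnusImage {a : TruncAlg ℝ q k} (ha : a ∈ realMagnusImage q k) (n : ℕ) :
    a ^ n ∈ realMagnusImage q k := by
  induction n with
  | zero => rw [pow_zero]; exact one_mem_realMagnusImage
  | succ n ih => rw [pow_succ]; exact mul_mem_realMagnusImage ih ha

theorem one_add_X_mem_realMagnusImage (i : Fin q) :
    (1 + X i : TruncAlg ℝ q k) ∈ realMagnusImage q k := by
  refine mem_realMagnusImage_iff.mpr ⟨fun w hw => ?_, fun J K h => ?_⟩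
  · rw [TruncAlg.add_apply, one_apply, if_pos hw, X, hw]
    simp
  · have hk : 0 < k := by omega
    have hval : ∀ w : Word q k, (1 + X i : TruncAlg ℝ q k) w =
        (if w.1 = [] then 1 else 0) + if w.1 = [i] then 1 else 0 := fun w => rfl
    have e1 : ∑ L : Word q k, (infil L.1 J.1 K.1 : ℝ) * (if L.1 = [] then 1 else 0) =
        infil [] J.1 K.1 := by
      rw [Finset.sum_eq_single ⟨[], hk⟩]
      · simp
      · intro L _ hL
        rw [if_neg fun h => hL (Subtype.ext h), mul_zero]
      · simp
    have e2 : ∑ L : Word q k, (infil L.1 J.1 K.1 : ℝ) * (if L.1 = [i] then 1 else 0) =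
        infil [i] J.1 K.1 := by
      by_cases hk1 : 1 < k
      · rw [Finset.sum_eq_single ⟨[i], hk1⟩]
        · simp
        · intro L _ hL
          rw [if_neg fun h => hL (Subtype.ext h), mul_zero]
        · simp
      · have hJ : J.1 = [] := List.length_eq_zero_iff.mp (by omega)
        have hK : K.1 = [] := List.length_eq_zero_iff.mp (by omega)
        rw [hJ, hK, Finset.sum_eq_zero]
        · simp [infil, headMatch]
        · intro L _
          rw [if_neg, mul_zero]
          intro hL
          have := L.2
          rw [hL] at this
          exact hk1 this
    simp only [shuffleSum, hval, mul_add, Finset.sum_add_distrib, e1, e2]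
    generalize J.1 = J
    generalize K.1 = K
    rcases J with _ | ⟨a, J⟩ <;> rcases K with _ | ⟨b, K⟩
    · simp [infil, headMatch]
    · simp only [infil, headMatch]
      by_cases hb : b = i <;> by_cases hK : K = [] <;> simp [hb, hK]
    · simp only [infil, headMatch]
      by_cases ha : a = i <;> by_cases hJ : J = [] <;> simp [ha, hJ]
    · simp only [infil, headMatch]
      by_cases ha : a = i <;> by_cases hJ : J = [] <;> by_cases hb : b = i <;>
        by_cases hK : K = [] <;> simp [ha, hJ, hb, hK]

/-! ### Real powers of unipotent elements -/

/-- The real power `u ^ t = ∑ (t choose j) (u - 1) ^ j`, for `u` with constant term `1`. -/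
noncomputable def unipotentPow (u : TruncAlg ℝ q k) (t : ℝ) : TruncAlg ℝ q k :=
  ∑ j ∈ Finset.range k, ((descPochhammer ℝ j).eval t / (j.factorial : ℝ)) • (u - 1) ^ j

/-- The coefficient of a word, as a linear form. -/
noncomputable def coeffHom (w : Word q k) : TruncAlg ℝ q k →ₗ[ℝ] ℝ where
  toFun a := a w
  map_add' _ _ := rfl
  map_smul' _ _ := rfl

/-- The coefficients of `u ^ t`, as polynomials in `t`. -/
noncomputable def unipotentPowPoly (u : TruncAlg ℝ q k) (w : Word q k) : Polynomial ℝ :=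
  ∑ j ∈ Finset.range k,
    Polynomial.C (((u - 1) ^ j) w / (j.factorial : ℝ)) * descPochhammer ℝ j

theorem eval_unipotentPowPoly (u : TruncAlg ℝ q k) (w : Word q k) (t : ℝ) :
    (unipotentPowPoly u w).eval t = unipotentPow u t w := by
  change _ = coeffHom w (unipotentPow u t)
  rw [unipotentPow, map_sum, unipotentPowPoly, Polynomial.eval_finsetSum]
  refine Finset.sum_congr rfl fun j _ => ?_
  rw [map_smul, Polynomial.eval_mul, Polynomial.eval_C, smul_eq_mul]
  change ((u - 1) ^ j) w / _ * _ = _ * ((u - 1) ^ j) w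
  ring

theorem orderGE_pow {f : TruncAlg ℝ q k} {n : ℕ} (hf : OrderGE n f) (j : ℕ) :
    OrderGE (n * j) (f ^ j) := by
  induction j with
  | zero => exact fun _ h => absurd h (by simp)
  | succ j ih =>
    rw [pow_succ, Nat.mul_succ]
    exact ih.mul hf

theorem orderGE_sub_one_iff {u : TruncAlg ℝ q k} :
    OrderGE 1 (u - 1) ↔ ∀ w : Word q k, w.1 = [] → u w = 1 := by
  refine forall_congr' fun w => ?_
  rw [Nat.lt_one_iff, List.length_eq_zero_iff]
  refine forall_congr' fun hw => ?_
  rw [TruncAlg.sub_apply, one_apply, if_pos hw, sub_eq_zero]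

theorem OrderGE.mono {f : TruncAlg ℝ q k} {m n : ℕ} (h : m ≤ n) (hf : OrderGE n f) :
    OrderGE m f := fun w hw => hf w (by omega)

theorem unipotentPow_natCast {u : TruncAlg ℝ q k} (hu : OrderGE 1 (u - 1)) (m : ℕ) :
    unipotentPow u m = u ^ m := by
  have hpow : ∀ j, k ≤ j → (u - 1) ^ j = 0 := fun j hj =>
    OrderGE.eq_zero (OrderGE.mono (by omega) (orderGE_pow hu j))
  have h1 : u ^ m = ∑ j ∈ Finset.range (m + 1), (m.choose j : ℝ) • (u - 1) ^ j := by
    conv_lhs => rw [← sub_add_cancel u 1, (Commute.one_right (u - 1)).add_pow]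
    refine Finset.sum_congr rfl fun j _ => ?_
    rw [one_pow, mul_one, Nat.cast_smul_eq_nsmul, nsmul_eq_mul]
    exact (Nat.cast_commute _ _).symm
  have h2 : ∀ j, (descPochhammer ℝ j).eval (m : ℝ) / (j.factorial : ℝ) = (m.choose j : ℝ) := by
    intro j
    rw [descPochhammer_eval_eq_descFactorial, Nat.descFactorial_eq_factorial_mul_choose,
      Nat.cast_mul, mul_div_cancel_left₀ _ (by positivity)]
  rw [h1, unipotentPow]
  simp only [h2]
  rcases le_total k (m + 1) with h | h
  · refine Finset.sum_subset (Finset.range_subset_range.mpr h) fun j _ hj => ?_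
    rw [hpow j (by simpa using hj), smul_zero]
  · refine (Finset.sum_subset (Finset.range_subset_range.mpr h) fun j _ hj => ?_).symm
    rw [Nat.choose_eq_zero_of_lt (by simp at hj; omega), Nat.cast_zero, zero_smul]

/-- Two polynomials with the same values at the natural numbers are equal. -/
theorem polynomial_eval_eq_of_nat {p r : Polynomial ℝ}
    (h : ∀ n : ℕ, p.eval (n : ℝ) = r.eval (n : ℝ)) (t : ℝ) : p.eval t = r.eval t := by
  rw [Polynomial.eq_of_infinite_eval_eq p r]
  refine Set.infinite_of_injective_forall_mem (f := fun n : ℕ => (n : ℝ)) Nat.cast_injective ?_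
  exact h

/-- Real powers satisfy the shuffle relations since natural powers do: the relations are polynomial
identities in the exponent. -/
theorem unipotentPow_mem {u : TruncAlg ℝ q k} (hu : u ∈ realMagnusImage q k) (t : ℝ) :
    unipotentPow u t ∈ realMagnusImage q k := by
  have hu1 := orderGE_sub_one_iff.mpr hu.1
  refine mem_realMagnusImage_iff.mpr ⟨fun w hw => ?_, fun J K h => ?_⟩
  · rw [← eval_unipotentPowPoly, polynomial_eval_eq_of_nat (r := 1), Polynomial.eval_one]
    intro n
    rw [eval_unipotentPowPoly, unipotentPow_natCast hu1, Polynomial.eval_one]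
    exact (pow_mem_realMagnusImage hu n).1 w hw
  · have key := polynomial_eval_eq_of_nat (p := unipotentPowPoly u J * unipotentPowPoly u K)
      (r := ∑ L : Word q k, Polynomial.C (infil L.1 J.1 K.1 : ℝ) * unipotentPowPoly u L) ?_ t
    · simpa only [Polynomial.eval_mul, Polynomial.eval_finsetSum, Polynomial.eval_C,
        eval_unipotentPowPoly, shuffleSum] using key
    · intro n
      simp only [Polynomial.eval_mul, Polynomial.eval_finsetSum, Polynomial.eval_C,
        eval_unipotentPowPoly, unipotentPow_natCast hu1]
      exact (mem_realMagnusImage_iff.mp (pow_mem_realMagnusImage hu n)).2 J K h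

/-- Both sides have coefficients which are polynomials in `t`, so it suffices to compare them for
natural exponents. -/
theorem unipotentPow_mul_self {u : TruncAlg ℝ q k} (hu : OrderGE 1 (u - 1)) (t : ℝ) :
    unipotentPow u t * u = unipotentPow u (t + 1) := by
  ext w
  have key := polynomial_eval_eq_of_nat
    (p := ∑ i ∈ Finset.range (w.1.length + 1),
      unipotentPowPoly u (w.take i) * Polynomial.C (u (w.drop i)))
    (r := (unipotentPowPoly u w).comp (Polynomial.X + 1)) ?_ t
  · simpa only [Polynomial.eval_mul, Polynomial.eval_finsetSum, Polynomial.eval_C,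
      eval_unipotentPowPoly, Polynomial.eval_comp, Polynomial.eval_add, Polynomial.eval_X,
      Polynomial.eval_one, ← mul_apply] using key
  · intro n
    simp only [Polynomial.eval_mul, Polynomial.eval_finsetSum, Polynomial.eval_C,
      eval_unipotentPowPoly, Polynomial.eval_comp, Polynomial.eval_add, Polynomial.eval_X,
      Polynomial.eval_one, ← mul_apply]
    rw [← Nat.cast_add_one, unipotentPow_natCast hu, unipotentPow_natCast hu, pow_succ]

theorem unipotentPow_neg_one_mul {u : TruncAlg ℝ q k} (hu : OrderGE 1 (u - 1)) :
    unipotentPow u (-1) * u = 1 := by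
  rw [unipotentPow_mul_self hu, neg_add_cancel]
  simpa using unipotentPow_natCast hu 0

theorem units_inv_mem_realMagnusImage {u : (TruncAlg ℝ q k)ˣ}
    (hu : (u : TruncAlg ℝ q k) ∈ realMagnusImage q k) :
    ((u⁻¹ : (TruncAlg ℝ q k)ˣ) : TruncAlg ℝ q k) ∈ realMagnusImage q k := by
  have h := unipotentPow_neg_one_mul (orderGE_sub_one_iff.mpr hu.1)
  rw [← Units.eq_mul_inv_iff_mul_eq, one_mul] at h
  rw [← h]
  exact unipotentPow_mem hu (-1)

theorem magnus_mem_realMagnusImage (x : FreeGroup (Fin q)) :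
    (magnus ℝ q k x : TruncAlg ℝ q k) ∈ realMagnusImage q k := by
  induction x using FreeGroup.induction_on with
  | C1 =>
    rw [map_one, Units.val_one]
    exact one_mem_realMagnusImage
  | of i =>
    have h : (magnus ℝ q k (FreeGroup.of i) : TruncAlg ℝ q k) = 1 + X i := by
      simp [magnus, oneAddX]
    exact h ▸ one_add_X_mem_realMagnusImage i
  | inv_of i hi =>
    have h := units_inv_mem_realMagnusImage hi
    rw [← map_inv] at h
    exact h
  | mul x y hx hy =>
    rw [map_mul, Units.val_mul]
    exact mul_mem_realMagnusImage hx hy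

theorem magnusBar_mem_realMagnusImage (g : FreeNilpotent q k) :
    (magnusBar ℝ q k g : TruncAlg ℝ q k) ∈ realMagnusImage q k := by
  induction g using QuotientGroup.induction_on with
  | H x => exact magnus_mem_realMagnusImage x

/-- If `u - 1` has order at least `n`, then `u ^ t` is `1 + t (u - 1)` up to degree `n`. -/
theorem unipotentPow_apply {n : ℕ} (hn : 1 ≤ n) {u : TruncAlg ℝ q k} (hu : OrderGE n (u - 1))
    (t : ℝ) {w : Word q k} (hw : w.1.length ≤ n) (hw0 : w.1 ≠ []) :
    unipotentPow u t w = t * u w := by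
  have hwk := w.2
  have hw1 := List.length_pos_iff.mpr hw0
  change coeffHom w (unipotentPow u t) = _
  rw [unipotentPow, map_sum, Finset.sum_eq_single 1]
  · rw [map_smul, pow_one]
    change _ * (u - 1) w = _
    rw [TruncAlg.sub_apply, one_apply_of_ne_nil hw0]
    simp
  · intro j hj hj1
    rw [map_smul]
    change _ * ((u - 1) ^ j) w = 0
    rcases Nat.eq_zero_or_pos j with rfl | hj0
    · rw [pow_zero, one_apply_of_ne_nil hw0, mul_zero]
    · rw [orderGE_pow hu j w, mul_zero]
      have : n * 2 ≤ n * j := Nat.mul_le_mul_left n (by omega)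
      omega
  · intro h
    exact absurd (Finset.mem_range.mpr (by omega)) h

theorem orderGE_unipotentPow_sub_one {n : ℕ} (hn : 1 ≤ n) {u : TruncAlg ℝ q k}
    (hu : OrderGE n (u - 1)) (t : ℝ) : OrderGE n (unipotentPow u t - 1) := by
  intro w hw
  by_cases hw0 : w.1 = []
  · have hu1 : OrderGE 1 (u - 1) := OrderGE.mono hn hu
    rw [TruncAlg.sub_apply, ← eval_unipotentPowPoly, polynomial_eval_eq_of_nat (r := 1),
      Polynomial.eval_one, one_apply, if_pos hw0, sub_self]
    intro m
    rw [eval_unipotentPowPoly, unipotentPow_natCast hu1, Polynomial.eval_one]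
    have h1 : OrderGE 1 (u ^ m - 1) := by
      rw [← mul_geom_sum]
      exact hu1.mul_right _
    exact orderGE_sub_one_iff.mp h1 w hw0
  · have h1 := hu w hw
    rw [TruncAlg.sub_apply, one_apply_of_ne_nil hw0, sub_zero] at h1 ⊢
    rw [unipotentPow_apply hn hu t hw.le hw0, h1, mul_zero]

theorem contDiff_unipotentPow (u : TruncAlg ℝ q k) : ContDiff ℝ ∞ (unipotentPow u) := by
  unfold unipotentPow
  refine ContDiff.sum fun j _ => ?_
  have h0 := Polynomial.contDiff_aeval (𝕜 := ℝ) (descPochhammer ℝ j) ∞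
  simp only [Polynomial.coe_aeval_eq_eval] at h0
  have h : ContDiff ℝ ∞ fun t : ℝ => (descPochhammer ℝ j).eval t / (j.factorial : ℝ) :=
    h0.div_const _
  exact h.smul (contDiff_const (c := (u - 1) ^ j))

end GroupLike

/-! ### Dynkin brackets and Ree's theorem -/

theorem exists_cons_and_concat {α : Type*} {v : List α} (hv : 0 < v.length) :
    ∃ (b c : α) (v₁ v₂ : List α), v = b :: v₁ ∧ v = v₂ ++ [c] := by
  have h : v ≠ [] := List.length_pos_iff.mp hv
  obtain ⟨b, v₁, h1⟩ := List.exists_cons_of_ne_nil h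
  exact ⟨b, v.getLast h, v₁, v.dropLast, h1, (List.dropLast_append_getLast h).symm⟩

section Dynkin

variable {α : Type*} [DecidableEq α]

theorem infil_nil_right (w v : List α) : infil w v [] = if w = v then 1 else 0 := by
  induction w generalizing v with
  | nil => cases v <;> simp [infil]
  | cons c w ih =>
    rcases v with _ | ⟨b, v⟩
    · simp [infil, headMatch]
    · by_cases hb : b = c
      · subst hb
        simp [infil, headMatch, ih]
      · simp [infil, headMatch, hb, Ne.symm hb]

/-- If `L = c :: w` is as long as `J` and `K` together, there are no overlaps. -/
theorem infil_cons_of_length {c : α} {w J K : List α} (h : J.length + K.length = w.length + 1) :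
    infil (c :: w) J K =
      headMatch c J (fun J' => infil w J' K) + headMatch c K (fun K' => infil w J K') := by
  rw [infil, Nat.add_eq_left]
  refine headMatch_eq_zero ?_
  rintro J' rfl
  refine headMatch_eq_zero ?_
  rintro K' rfl
  simp only [List.length_cons] at h
  exact infil_eq_zero_of_length (by omega)

/-- The sum over the factorizations `v = p s` of the number of ways in which `w` is a shuffle of
`p` and the reversal of `s`, with the sign `(-1) ^ |s|` and the weight `f |p|`. In the
shuffle algebra, for words of equal length, the weight `f = 1` gives the convolution of the identity
and the antipode, the weight `f = id` the convolution of the degree operator and the antipode. -/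
def antipodeSum (f : ℕ → ℝ) (w v : List α) : ℝ :=
  ∑ i ∈ Finset.range (v.length + 1),
    f i * (-1) ^ (v.drop i).length * infil w (v.take i) (v.drop i).reverse

/-- The terms of `antipodeSum f (a :: w) (b :: v)` in which the first letter `a` comes from `p`. -/
theorem antipodeSum_cons_left (f : ℕ → ℝ) (a b : α) (w v : List α) :
    ∑ i ∈ Finset.range ((b :: v).length + 1), f i * (-1) ^ ((b :: v).drop i).length *
      ((headMatch a ((b :: v).take i) fun J => infil w J ((b :: v).drop i).reverse : ℕ) : ℝ) =
    if b = a then antipodeSum (fun i => f (i + 1)) w v else 0 := by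
  rw [Finset.sum_range_succ']
  simp only [List.take_succ_cons, List.drop_succ_cons, headMatch, List.take_zero, Nat.cast_zero,
    mul_zero, add_zero, List.length_cons]
  split_ifs
  · rfl
  · simp

/-- The terms of `antipodeSum f (a :: w) (v ++ [b])` in which the first letter `a` comes from the
reversal of `s`. -/
theorem antipodeSum_cons_right (f : ℕ → ℝ) (a b : α) (w v : List α) :
    ∑ i ∈ Finset.range ((v ++ [b]).length + 1), f i * (-1) ^ ((v ++ [b]).drop i).length *
      ((headMatch a ((v ++ [b]).drop i).reverse fun K => infil w ((v ++ [b]).take i) K : ℕ) : ℝ) =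
    if b = a then -antipodeSum f w v else 0 := by
  rw [Finset.sum_range_succ, List.drop_length]
  have hnil : ∀ f, headMatch a ([] : List α) f = 0 := fun _ => rfl
  rw [List.reverse_nil, hnil, Nat.cast_zero, mul_zero, add_zero]
  have h : ∀ i ∈ Finset.range (v ++ [b]).length,
      f i * (-1) ^ ((v ++ [b]).drop i).length *
      ((headMatch a ((v ++ [b]).drop i).reverse fun K => infil w ((v ++ [b]).take i) K : ℕ) : ℝ) =
      if b = a then
        -(f i * (-1) ^ (v.drop i).length * infil w (v.take i) (v.drop i).reverse) else 0 := by
    intro i hi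
    have hi' : i ≤ v.length := by
      simp at hi
      omega
    rw [List.drop_append_of_le_length hi', List.take_append_of_le_length hi', List.reverse_append]
    simp only [List.reverse_singleton, List.singleton_append, headMatch, List.length_append,
      List.length_singleton, pow_succ]
    split_ifs
    · ring
    · simp
  rw [Finset.sum_congr rfl h, List.length_append, List.length_singleton]
  split_ifs
  · rw [Finset.sum_neg_distrib, antipodeSum]
  · simp

/-- This recursion is the one of a commutator with the letter `a`, except that `f` is shifted in the
first term. -/
theorem antipodeSum_cons (f : ℕ → ℝ) (a b c : α) (w v v' u : List α) (hv : u = b :: v)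
    (hv' : u = v' ++ [c]) (hl : u.length = w.length + 1) :
    antipodeSum f (a :: w) u = (if b = a then antipodeSum (fun i => f (i + 1)) w v else 0) -
      if c = a then antipodeSum f w v' else 0 := by
  have h : ∀ i ∈ Finset.range (u.length + 1),
      f i * (-1) ^ (u.drop i).length * (infil (a :: w) (u.take i) (u.drop i).reverse : ℝ) =
      f i * (-1) ^ (u.drop i).length *
        ((headMatch a (u.take i) fun J => infil w J (u.drop i).reverse : ℕ) : ℝ) +
      f i * (-1) ^ (u.drop i).length *
        ((headMatch a (u.drop i).reverse fun K => infil w (u.take i) K : ℕ) : ℝ) := by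
    intro i hi
    rw [Finset.mem_range] at hi
    rw [infil_cons_of_length, Nat.cast_add, mul_add]
    rw [List.length_reverse, List.length_take, List.length_drop]
    omega
  rw [antipodeSum, Finset.sum_congr rfl h, Finset.sum_add_distrib]
  conv_lhs => arg 1; rw [hv, antipodeSum_cons_left]
  conv_lhs => arg 2; rw [hv', antipodeSum_cons_right]
  split_ifs <;> ring

/-- The convolution of the identity and the antipode vanishes in positive degree. -/
theorem antipodeSum_one_eq_zero {w v : List α} (hw : 0 < w.length) (h : v.length = w.length) :
    antipodeSum (fun _ => 1) w v = 0 := by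
  induction w generalizing v with
  | nil => simp at hw
  | cons a w ih =>
    obtain ⟨b, c, v₁, v₂, h1, h2⟩ := exists_cons_and_concat (v := v) (by omega)
    have l1 : v₁.length = w.length := by simpa [h1] using h
    have l2 : v₂.length = w.length := by simpa [h2] using h
    rw [antipodeSum_cons _ a b c w v₁ v₂ v h1 h2 h]
    rcases Nat.eq_zero_or_pos w.length with hw0 | hw0
    · obtain rfl := List.length_eq_zero_iff.mp hw0
      obtain rfl := List.length_eq_zero_iff.mp l1
      obtain rfl := List.length_eq_zero_iff.mp l2
      rw [h1] at h2
      obtain rfl : b = c := by simpa using h2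
      simp
    · rw [ih hw0 l1, ih hw0 l2]
      simp

end Dynkin

section Ree

variable {q k : ℕ}

open scoped commutatorElement in
/-- The right-normed commutator `[x_{i_1}, [x_{i_2}, …]]` attached to a word. -/
def dynkinElt : List (Fin q) → FreeGroup (Fin q)
  | [] => 1
  | [a] => FreeGroup.of a
  | a :: b :: w => ⁅FreeGroup.of a, dynkinElt (b :: w)⁆

theorem dynkinElt_mem (w : List (Fin q)) :
    dynkinElt w ∈ lcsWeight (FreeGroup (Fin q)) w.length := by
  induction w using dynkinElt.induct with
  | case1 => exact one_mem _
  | case2 a => exact Subgroup.mem_top _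
  | case3 a b w ih =>
    refine commutator_mem_lcsWeight (m := 1) le_rfl (by simp) ?_ (Subgroup.mem_top _) ih
    simp [add_comm]

theorem magnus_of_apply (a : Fin q) {L : Word q k} (hL : L.1.length = 1) :
    (magnus ℝ q k (FreeGroup.of a) : TruncAlg ℝ q k) L = if L.1 = [a] then 1 else 0 := by
  have h : (magnus ℝ q k (FreeGroup.of a) : TruncAlg ℝ q k) - 1 = X a := by
    simp [magnus, oneAddX]
  rw [← magnus_sub_one_apply (Word.ne_nil_of_length le_rfl hL), h]
  rfl

/-- The right-normed bracketing is the convolution of the degree operator and the antipode. In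
the induction the shift of the weight `id` by one does not matter, by `antipodeSum_one_eq_zero`. -/
theorem magnus_dynkinElt_apply (w : List (Fin q)) (hw : 0 < w.length) {L : Word q k}
    (hL : L.1.length = w.length) :
    (magnus ℝ q k (dynkinElt w) : TruncAlg ℝ q k) L = antipodeSum (fun i => (i : ℝ)) w L.1 := by
  induction w using dynkinElt.induct generalizing L with
  | case1 => simp at hw
  | case2 a =>
    rw [dynkinElt, magnus_of_apply a hL]
    obtain ⟨b, hb⟩ := List.length_eq_one_iff.mp hL
    rw [hb]
    by_cases hba : b = a <;>
      simp [antipodeSum, Finset.sum_range_succ, infil, headMatch, hba]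
  | case3 a b w ih =>
    obtain ⟨x, y, v₁, v₂, h1, h2⟩ := exists_cons_and_concat (v := L.1) (by omega)
    have l1 : v₁.length = (b :: w).length := by
      rw [h1] at hL
      simpa using hL
    have l2 : v₂.length = (b :: w).length := by
      rw [h2] at hL
      simpa using hL
    rw [antipodeSum_cons _ a x y (b :: w) v₁ v₂ L.1 h1 h2 hL, dynkinElt,
      magnus_commutator_apply (m := 1) (n := (b :: w).length) le_rfl (by simp)
        (Subgroup.mem_top _) (dynkinElt_mem _) (by rw [hL]; simp [add_comm])]
    have t1 : (L.take 1).1 = [x] := by simp [Word.take, h1]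
    have t2 : (L.drop 1).1 = v₁ := by simp [Word.drop, h1]
    have t3 : (L.take (b :: w).length).1 = v₂ := by
      rw [← l2]
      simp only [Word.take, h2]
      exact List.take_left
    have t4 : (L.drop (b :: w).length).1 = [y] := by
      rw [← l2]
      simp only [Word.drop, h2]
      exact List.drop_left
    rw [ih (by simp) (by rw [t2, l1]), ih (by simp) (by rw [t3, l2]),
      magnus_of_apply a (by rw [t1]; rfl), magnus_of_apply a (by rw [t4]; rfl), t1, t2, t3, t4]
    have e1 : antipodeSum (fun i => ((i + 1 : ℕ) : ℝ)) (b :: w) v₁ =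
        antipodeSum (fun i => (i : ℝ)) (b :: w) v₁ := by
      have h0 := antipodeSum_one_eq_zero (w := b :: w) (v := v₁) (by simp) l1
      rw [antipodeSum] at h0 ⊢
      rw [antipodeSum, ← sub_eq_zero, ← Finset.sum_sub_distrib, ← h0]
      refine Finset.sum_congr rfl fun i _ => ?_
      push_cast
      ring
    rw [e1]
    by_cases hx : x = a <;> by_cases hy : y = a <;> simp [hx, hy]

/-- Ree's theorem: if `f` has order at least `n` and is annihilated by proper shuffles in degree
`n`, then its degree `n` part is `1 / n` times its right-normed bracketing. -/
theorem natCast_mul_eq_sum_dynkin {n : ℕ} (hn : 1 ≤ n) {f : TruncAlg ℝ q k} (hf : OrderGE n f)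
    (hprim : ∀ J K : List (Fin q), J ≠ [] → K ≠ [] → J.length + K.length = n →
      shuffleSum f J K = 0) {v : Word q k} (hv : v.1.length = n) :
    (n : ℝ) * f v = ∑ L : Word q k,
      f L * if L.1.length = n then (magnus ℝ q k (dynkinElt L.1) : TruncAlg ℝ q k) v else 0 := by
  have h1 : ∀ L : Word q k,
      (f L * if L.1.length = n then (magnus ℝ q k (dynkinElt L.1) : TruncAlg ℝ q k) v else 0) =
      ∑ i ∈ Finset.range (v.1.length + 1), (i : ℝ) * (-1) ^ (v.1.drop i).length *
        ((infil L.1 (v.1.take i) (v.1.drop i).reverse : ℝ) * f L) := by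
    intro L
    rcases lt_trichotomy L.1.length n with h | h | h
    · rw [hf L h, zero_mul, Finset.sum_eq_zero]
      simp
    · rw [if_pos h, magnus_dynkinElt_apply L.1 (by omega) (by omega), antipodeSum, Finset.mul_sum]
      refine Finset.sum_congr rfl fun i _ => ?_
      ring
    · rw [if_neg h.ne', mul_zero, Finset.sum_eq_zero]
      intro i hi
      rw [infil_eq_zero_of_length, Nat.cast_zero, zero_mul, mul_zero]
      rw [List.length_reverse, ← List.length_append, List.take_append_drop]
      omega
  rw [Finset.sum_congr rfl fun L _ => h1 L, Finset.sum_comm]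
  simp only [← Finset.mul_sum]
  rw [Finset.sum_eq_single v.1.length]
  · rw [List.drop_length, List.take_length, hv, List.length_nil, pow_zero, mul_one,
      List.reverse_nil]
    congr 1
    rw [Finset.sum_eq_single v]
    · simp [infil_nil_right]
    · intro L _ hL
      rw [infil_nil_right, if_neg fun h => hL (Subtype.ext h), Nat.cast_zero, zero_mul]
    · simp
  · intro i hi hin
    rw [Finset.mem_range] at hi
    rcases Nat.eq_zero_or_pos i with rfl | hi0
    · simp
    · have := hprim (v.1.take i) (v.1.drop i).reverse (List.length_pos_iff.mp (by simp; omega))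
        (List.length_pos_iff.mp (by simp; omega)) (by simp; omega)
      rw [shuffleSum] at this
      rw [this, mul_zero]
  · intro h
    exact absurd (Finset.mem_range.mpr (Nat.lt_succ_self _)) h

/-- The degree `n` part of the Magnus expansion of any element of weight `n` is a combination of
those of the Lyndon commutators. -/
theorem leadingPart_mem_span {n : ℕ} (hn : 1 ≤ n) {x : FreeGroup (Fin q)}
    (hx : x ∈ lcsWeight (FreeGroup (Fin q)) n) :
    (fun L : {L : Word q k // L.1.length = n} => (magnus ℝ q k x : TruncAlg ℝ q k) L.1) ∈
      Submodule.span ℝ ((fun w (L : {L : Word q k // L.1.length = n}) =>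
        (magnus ℝ q k (lyndonElt FreeGroup.of w) : TruncAlg ℝ q k) L.1) ''
          {w | IsLyndon w ∧ w.length = n}) := by
  set V := Submodule.span ℝ ((fun w (L : {L : Word q k // L.1.length = n}) =>
        (magnus ℝ q k (lyndonElt FreeGroup.of w) : TruncAlg ℝ q k) L.1) ''
          {w | IsLyndon w ∧ w.length = n}) with hV
  have hle : Subgroup.closure (lyndonElt FreeGroup.of '' {w | IsLyndon w ∧ w.length = n}) ⊔
      lcsWeight (FreeGroup (Fin q)) (n + 1) ≤
      (V.toAddSubgroup.toSubgroup.comap (leadingPart q k hn)).map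
        (lcsWeight (FreeGroup (Fin q)) n).subtype := by
    refine sup_le ((Subgroup.closure_le _).mpr ?_) ?_
    · rintro _ ⟨w, hw, rfl⟩
      have hgw := lyndonElt_mem (FreeGroup.of) w
      rw [hw.2] at hgw
      exact ⟨⟨_, hgw⟩, Submodule.subset_span ⟨w, hw, rfl⟩, rfl⟩
    · intro y hy
      refine ⟨⟨y, lcsWeight_antitone (Nat.le_succ n) hy⟩, ?_, rfl⟩
      change (fun L : {L : Word q k // L.1.length = n} =>
        (magnus ℝ q k y : TruncAlg ℝ q k) L.1) ∈ V
      convert V.zero_mem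
      rename_i L
      exact magnus_apply_eq_zero hy L.2 hn
  obtain ⟨y, hy, rfl⟩ :=
    hle (lcsWeight_le_closure_lyndonElt FreeGroup.of (FreeGroup.closure_range_of _) hn hx)
  exact hy

/-- A combination of leading parts of Lyndon commutators vanishes if its coefficients at the Lyndon
words do. -/
theorem eq_zero_of_mem_span_lyndon {n : ℕ} (hnk : n < k)
    {f : {L : Word q k // L.1.length = n} → ℝ}
    (hf : f ∈ Submodule.span ℝ ((fun w (L : {L : Word q k // L.1.length = n}) =>
      (magnus ℝ q k (lyndonElt FreeGroup.of w) : TruncAlg ℝ q k) L.1) ''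
        {w | IsLyndon w ∧ w.length = n}))
    (h0 : ∀ L, IsLyndon L.1.1 → f L = 0) : f = 0 := by
  classical
  set φ := fun w (L : {L : Word q k // L.1.length = n}) =>
      (magnus ℝ q k (lyndonElt FreeGroup.of w) : TruncAlg ℝ q k) L.1 with hφ
  have key : ∀ S : Finset (List (Fin q)), (∀ w ∈ S, IsLyndon w ∧ w.length = n) →
      ∀ f ∈ Submodule.span ℝ (φ '' (S : Set (List (Fin q)))),
      (∀ L, IsLyndon L.1.1 → f L = 0) → f = 0 := by
    intro S
    induction S using Finset.induction_on_min with
    | empty =>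
      intro _ f hf _
      simpa using hf
    | insert a s has ih =>
      intro hS f hf hf0
      have ha := hS a (Finset.mem_insert_self a s)
      have hs : ∀ w ∈ s, IsLyndon w ∧ w.length = n := fun w hw => hS w (Finset.mem_insert_of_mem hw)
      let La : {L : Word q k // L.1.length = n} := ⟨⟨a, by omega⟩, ha.2⟩
      rw [Finset.coe_insert, Set.image_insert_eq] at hf
      obtain ⟨c, g, hg, rfl⟩ := Submodule.mem_span_insert.mp hf
      have hg0 : g La = 0 := by
        have : Submodule.span ℝ (φ '' (s : Set (List (Fin q)))) ≤
            LinearMap.ker (LinearMap.proj (R := ℝ) (φ := fun _ => ℝ) La) := by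
          rw [Submodule.span_le]
          rintro _ ⟨w, hw, rfl⟩
          change (magnus ℝ q k (lyndonElt FreeGroup.of w) : TruncAlg ℝ q k) La.1 = 0
          rw [magnus_lyndonElt_apply (hs w hw).1 (ha.2.trans (hs w hw).2.symm) (has w hw).le,
              if_neg (has w hw).ne]
        exact this hg
      have hc : c = 0 := by
        have h1 := hf0 La ha.1
        have h2 : φ a La = 1 := by
          simp only [hφ]
          rw [magnus_lyndonElt_apply (L := La.1) ha.1 rfl le_rfl, if_pos rfl]
        rw [Pi.add_apply, Pi.smul_apply, h2, hg0] at h1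
        simpa using h1
      subst hc
      rw [zero_smul, zero_add] at hf0 ⊢
      exact ih hs g hg hf0
  have hfin : {w : List (Fin q) | IsLyndon w ∧ w.length = n}.Finite :=
    (List.finite_length_eq (Fin q) n).subset fun w hw => hw.2
  exact key hfin.toFinset (fun w hw => by simpa using hw) f (by simpa using hf) h0

/-- An element satisfying the shuffle relations is determined by the coefficients of the Lyndon
words. The part of lowest degree of the difference of two such elements is annihilated by proper
shuffles, hence is a combination of the leading parts of Lyndon commutators. -/
theorem realMagnusImage_ext {a b : TruncAlg ℝ q k} (ha : a ∈ realMagnusImage q k)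
    (hb : b ∈ realMagnusImage q k) (hab : ∀ w : Word q k, IsLyndon w.1 → a w = b w) : a = b := by
  rw [mem_realMagnusImage_iff] at ha hb
  rw [← sub_eq_zero]
  refine OrderGE.eq_zero ?_
  suffices h : ∀ n, n ≤ k → OrderGE n (a - b) from h k le_rfl
  intro n
  induction n with
  | zero => exact fun _ _ h => absurd h (Nat.not_lt_zero _)
  | succ n ih =>
    intro hnk w hw
    have ihn := ih (by omega)
    rcases Nat.lt_succ_iff_lt_or_eq.mp hw with hw | hw
    · exact ihn w hw
    · rcases Nat.eq_zero_or_pos n with rfl | hn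
      · have hw' := List.length_eq_zero_iff.mp hw
        rw [TruncAlg.sub_apply, ha.1 w hw', hb.1 w hw', sub_self]
      · have hprim : ∀ J K : List (Fin q), J ≠ [] → K ≠ [] → J.length + K.length = n →
            shuffleSum (a - b) J K = 0 := by
          intro J K hJ hK hJK
          have hJ' := List.length_pos_iff.mpr hJ
          have hK' := List.length_pos_iff.mpr hK
          let J' : Word q k := ⟨J, by omega⟩
          let K' : Word q k := ⟨K, by omega⟩
          have e1 : shuffleSum (a - b) J K = shuffleSum a J K - shuffleSum b J K := by
            simp only [shuffleSum, TruncAlg.sub_apply, mul_sub, Finset.sum_sub_distrib]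
          have e2 := ha.2 J' K' (by change J.length + K.length < k; omega)
          have e3 := hb.2 J' K' (by change J.length + K.length < k; omega)
          have e4 : a J' = b J' := sub_eq_zero.mp (ihn J' (by change J.length < n; omega))
          have e5 : a K' = b K' := sub_eq_zero.mp (ihn K' (by change K.length < n; omega))
          rw [e1, ← e2, ← e3, e4, e5, sub_self]
        let f : {L : Word q k // L.1.length = n} → ℝ := fun L => (a - b) L.1
        have hspan : (n : ℝ) • f = ∑ L : Word q k, (a - b) L • fun v =>
            if L.1.length = n then (magnus ℝ q k (dynkinElt L.1) : TruncAlg ℝ q k) v.1 else 0 := by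
          funext v
          rw [Finset.sum_apply]
          exact natCast_mul_eq_sum_dynkin hn ihn hprim v.2
        have hf : f = 0 := by
          refine eq_zero_of_mem_span_lyndon (by omega) ?_ fun L hL => ?_
          · rw [← Submodule.smul_mem_iff _ (Nat.cast_ne_zero.mpr hn.ne' : (n : ℝ) ≠ 0), hspan]
            refine Submodule.sum_mem _ fun L _ => Submodule.smul_mem _ _ ?_
            by_cases hL : L.1.length = n
            · simp only [if_pos hL]
              refine leadingPart_mem_span hn ?_
              rw [← hL]
              exact dynkinElt_mem L.1
            · simp only [if_neg hL]
              exact Submodule.zero_mem _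
          · exact sub_eq_zero.mpr (hab L.1 hL)
        exact congrFun hf ⟨w, hw⟩

end Ree

/-! ### Lyndon coordinates -/

section Coordinates

variable {q k : ℕ}

/-- The Lyndon words of length `< k`. They are ordered by length and then lexicographically. -/
@[ext] structure LyndonWord (q k : ℕ) : Type where
  /-- The underlying word. -/
  val : Word q k
  /-- The word is a Lyndon word. -/
  isLyndon : IsLyndon val.1

noncomputable instance : Fintype (LyndonWord q k) :=
  @Fintype.ofFinite _ (Finite.of_injective LyndonWord.val fun _ _ => LyndonWord.ext)

noncomputable instance : LinearOrder (LyndonWord q k) :=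
  LinearOrder.lift' (fun w => toLex (w.1.1.length, w.1.1)) fun w w' h => by
    have h1 := congrArg (fun p => (ofLex p).2) h
    exact LyndonWord.ext (Subtype.ext h1)

theorem LyndonWord.lt_iff {w w' : LyndonWord q k} :
    w < w' ↔ w.1.1.length < w'.1.1.length ∨ w.1.1.length = w'.1.1.length ∧ w.1.1 < w'.1.1 :=
  Prod.Lex.toLex_lt_toLex

theorem mul_apply_of_orderGE_sub_one {a v : TruncAlg ℝ q k} {n : ℕ}
    (ha : ∀ w : Word q k, w.1 = [] → a w = 1) (hv : OrderGE n (v - 1)) {L : Word q k}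
    (hL : L.1.length ≤ n) (hL0 : L.1 ≠ []) : (a * v) L = a L + v L := by
  have h : a * v = a + a * (v - 1) := by noncomm_ring
  rw [h, TruncAlg.add_apply, mul_apply, Finset.sum_eq_single 0]
  · have h1 : L.drop 0 = L := Subtype.ext (by simp [Word.drop])
    rw [ha (L.take 0) (by simp [Word.take]), h1, one_mul, TruncAlg.sub_apply,
      one_apply_of_ne_nil hL0, sub_zero]
  · intro i hi hi0
    rw [Finset.mem_range] at hi
    have := List.length_pos_iff.mpr hL0
    rw [hv _ (by rw [Word.length_drop]; omega), mul_zero]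
  · simp

/-- The Magnus expansion of the Lyndon commutator of a Lyndon word. -/
noncomputable def lyndonUnit (w : LyndonWord q k) : TruncAlg ℝ q k :=
  magnus ℝ q k (lyndonElt FreeGroup.of w.1.1)

theorem LyndonWord.one_le_length (w : LyndonWord q k) : 1 ≤ w.1.1.length :=
  List.length_pos_iff.mpr w.2.1

theorem orderGE_lyndonUnit_sub_one (w : LyndonWord q k) :
    OrderGE w.1.1.length (lyndonUnit w - 1) :=
  orderGE_magnus_sub_one_of_mem w.one_le_length (lyndonElt_mem _ _)

theorem lyndonUnit_apply_self (w : LyndonWord q k) : lyndonUnit w w.1 = 1 := by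
  rw [lyndonUnit, magnus_lyndonElt_apply w.2 rfl le_rfl, if_pos rfl]

theorem lyndonUnit_apply_of_lt {w w' : LyndonWord q k} (h : w' < w) : lyndonUnit w w'.1 = 0 := by
  rcases LyndonWord.lt_iff.mp h with h | ⟨h1, h2⟩
  · have := orderGE_lyndonUnit_sub_one w w'.1 h
    rwa [TruncAlg.sub_apply, one_apply_of_ne_nil w'.2.1, sub_zero] at this
  · rw [lyndonUnit, magnus_lyndonElt_apply w.2 h1 h2.le, if_neg h2.ne]

theorem LyndonWord.length_le {w w' : LyndonWord q k} (h : w' ≤ w) :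
    w'.1.1.length ≤ w.1.1.length := by
  rcases h.eq_or_lt with rfl | h
  · exact le_rfl
  · rcases LyndonWord.lt_iff.mp h with h | ⟨h, -⟩
    · exact h.le
    · exact h.le

/-- Multiplication with a real power of a Lyndon unit is a translation of the Lyndon coordinates of
words up to `w`. -/
theorem mul_unipotentPow_apply {a : TruncAlg ℝ q k} (ha : ∀ w : Word q k, w.1 = [] → a w = 1)
    (t : ℝ) {w w' : LyndonWord q k} (h : w' ≤ w) :
    (a * unipotentPow (lyndonUnit w) t) w'.1 = a w'.1 + t * lyndonUnit w w'.1 := by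
  have hl := LyndonWord.length_le h
  rw [mul_apply_of_orderGE_sub_one ha (orderGE_unipotentPow_sub_one w.one_le_length
    (orderGE_lyndonUnit_sub_one w) t) hl w'.2.1, unipotentPow_apply w.one_le_length
    (orderGE_lyndonUnit_sub_one w) t hl w'.2.1]

theorem lyndonUnit_mem (w : LyndonWord q k) : lyndonUnit w ∈ realMagnusImage q k :=
  magnus_mem_realMagnusImage _

theorem TruncAlg.contDiff_iff {E : Type*} [NormedAddCommGroup E] [NormedSpace ℝ E]
    {f : E → TruncAlg ℝ q k} : ContDiff ℝ ∞ f ↔ ∀ w, ContDiff ℝ ∞ fun x => f x w :=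
  contDiff_pi (F' := fun _ : Word q k => ℝ)

theorem TruncAlg.continuous_iff {E : Type*} [TopologicalSpace E]
    {f : E → TruncAlg ℝ q k} : Continuous f ↔ ∀ w, Continuous fun x => f x w :=
  continuous_pi_iff (A := fun _ : Word q k => ℝ)

theorem TruncAlg.contDiff_mul {E : Type*} [NormedAddCommGroup E] [NormedSpace ℝ E]
    {f g : E → TruncAlg ℝ q k} (hf : ContDiff ℝ ∞ f) (hg : ContDiff ℝ ∞ g) :
    ContDiff ℝ ∞ fun x => f x * g x := by
  rw [contDiff_iff] at hf hg ⊢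
  intro w
  simp only [mul_apply]
  exact ContDiff.sum fun i _ => (hf _).mul (hg _)

theorem TruncAlg.continuous_mul {E : Type*} [TopologicalSpace E]
    {f g : E → TruncAlg ℝ q k} (hf : Continuous f) (hg : Continuous g) :
    Continuous fun x => f x * g x := by
  rw [continuous_iff] at hf hg ⊢
  intro w
  simp only [mul_apply]
  exact continuous_finsetSum _ fun i _ => (hf _).mul (hg _)

/-- The coefficients of the Lyndon words can be prescribed arbitrarily, in a smooth way. A larger
Lyndon word is adjusted by a real power of its Lyndon unit, which leaves the coefficients of the
smaller Lyndon words unchanged. -/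
theorem exists_contDiff_lyndon_section :
    ∃ S : (LyndonWord q k → ℝ) → TruncAlg ℝ q k, ContDiff ℝ ∞ S ∧
      (∀ c, S c ∈ realMagnusImage q k) ∧ ∀ c w, S c w.1 = c w := by
  classical
  suffices h : ∀ s : Finset (LyndonWord q k), ∃ S : (LyndonWord q k → ℝ) → TruncAlg ℝ q k,
      ContDiff ℝ ∞ S ∧ (∀ c, S c ∈ realMagnusImage q k) ∧ ∀ c, ∀ w ∈ s, S c w.1 = c w by
    obtain ⟨S, h1, h2, h3⟩ := h Finset.univ
    exact ⟨S, h1, h2, fun c w => h3 c w (Finset.mem_univ w)⟩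
  intro s
  induction s using Finset.induction_on_max with
  | empty =>
    exact ⟨fun _ => 1, contDiff_const, fun _ => one_mem_realMagnusImage, by simp⟩
  | insert a s has ih =>
    obtain ⟨S, h1, h2, h3⟩ := ih
    refine ⟨fun c => S c * unipotentPow (lyndonUnit a) (c a - S c a.1), ?_, fun c => ?_, ?_⟩
    · refine TruncAlg.contDiff_mul h1 ((contDiff_unipotentPow _).comp ?_)
      exact (contDiff_apply ℝ ℝ a).sub (TruncAlg.contDiff_iff.mp h1 a.1)
    · exact mul_mem_realMagnusImage (h2 c) (unipotentPow_mem (lyndonUnit_mem a) _)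
    · intro c w hw
      beta_reduce
      rcases Finset.mem_insert.mp hw with rfl | hw
      · rw [mul_unipotentPow_apply (h2 c).1 _ le_rfl, lyndonUnit_apply_self]
        ring
      · rw [mul_unipotentPow_apply (h2 c).1 _ (has w hw).le, lyndonUnit_apply_of_lt (has w hw),
          mul_zero, add_zero, h3 c w hw]

theorem magnus_zpow_lyndonElt_apply (z : ℤ) {w w' : LyndonWord q k} (h : w' ≤ w) :
    (magnus ℝ q k (lyndonElt FreeGroup.of w.1.1 ^ z) : TruncAlg ℝ q k) w'.1 =
      z * lyndonUnit w w'.1 := by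
  have hmem := zpow_mem (lyndonElt_mem FreeGroup.of w.1.1) z
  rcases (LyndonWord.length_le h).eq_or_lt with hl | hl
  · have e := congrArg (fun f => f.toAdd ⟨w'.1, hl⟩)
      (map_zpow (leadingPart q k w.one_le_length) ⟨_, lyndonElt_mem FreeGroup.of w.1.1⟩ z)
    simp only [toAdd_zpow, Pi.smul_apply, leadingPart_apply, zsmul_eq_mul] at e
    exact e
  · have e1 := orderGE_magnus_sub_one_of_mem (k := k) w.one_le_length hmem w'.1 hl
    have e2 := orderGE_lyndonUnit_sub_one w w'.1 hl
    rw [TruncAlg.sub_apply, one_apply_of_ne_nil w'.2.1, sub_zero] at e1 e2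
    rw [e1, e2, mul_zero]

/-- Every orbit has a point whose Lyndon coordinates lie in the unit interval: multiplication with
an integral power of the Lyndon commutator of `w` changes the coordinate of `w` by an integer and
leaves the coordinates of the smaller words unchanged. -/
theorem exists_magnus_mul_mem_Icc {a : TruncAlg ℝ q k} (ha : a ∈ realMagnusImage q k) :
    ∃ x : FreeGroup (Fin q), ∀ w : LyndonWord q k,
      (a * (magnus ℝ q k x : TruncAlg ℝ q k)) w.1 ∈ Set.Icc (0 : ℝ) 1 := by
  classical
  suffices h : ∀ s : Finset (LyndonWord q k), ∃ x : FreeGroup (Fin q), ∀ w ∈ s,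
      (a * (magnus ℝ q k x : TruncAlg ℝ q k)) w.1 ∈ Set.Icc (0 : ℝ) 1 by
    obtain ⟨x, hx⟩ := h Finset.univ
    exact ⟨x, fun w => hx w (Finset.mem_univ w)⟩
  intro s
  induction s using Finset.induction_on_max with
  | empty => exact ⟨1, by simp⟩
  | insert a' s has ih =>
    obtain ⟨x, hx⟩ := ih
    set b := a * (magnus ℝ q k x : TruncAlg ℝ q k) with hb
    have hb1 := (mul_mem_realMagnusImage ha (magnus_mem_realMagnusImage x)).1
    set z : ℤ := -⌊b a'.1⌋ with hz
    refine ⟨x * lyndonElt FreeGroup.of a'.1.1 ^ z, ?_⟩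
    have key : ∀ w : LyndonWord q k, w ≤ a' →
        (a * (magnus ℝ q k (x * lyndonElt FreeGroup.of a'.1.1 ^ z) : TruncAlg ℝ q k)) w.1 =
          b w.1 + z * lyndonUnit a' w.1 := by
      intro w hw
      rw [map_mul, Units.val_mul, ← mul_assoc, ← hb, mul_apply_of_orderGE_sub_one hb1
        (orderGE_magnus_sub_one_of_mem a'.one_le_length
          (zpow_mem (lyndonElt_mem FreeGroup.of a'.1.1) z)) (LyndonWord.length_le hw) w.2.1,
        magnus_zpow_lyndonElt_apply z hw]
    intro w hw
    rcases Finset.mem_insert.mp hw with rfl | hw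
    · rw [key w le_rfl, lyndonUnit_apply_self, hz]
      push_cast
      constructor
      · linarith [Int.floor_le (b w.1)]
      · linarith [Int.lt_floor_add_one (b w.1)]
    · rw [key w (has w hw).le, lyndonUnit_apply_of_lt (has w hw), mul_zero, add_zero]
      exact hx w hw

/-- The number of Lyndon words of length `< k`, i.e. the dimension of `realMagnusImage q k`. -/
noncomputable def lyndonDim (q k : ℕ) : ℕ := Fintype.card (LyndonWord q k)

/-- An enumeration of the Lyndon words of length `< k`. -/
noncomputable def lyndonIndex (q k : ℕ) : LyndonWord q k ≃ Fin (lyndonDim q k) :=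
  Fintype.equivFin (LyndonWord q k)

/-- The coefficients of the Lyndon words. -/
noncomputable def lyndonCoord (q k : ℕ) :
    TruncAlg ℝ q k →L[ℝ] EuclideanSpace ℝ (Fin (lyndonDim q k)) :=
  (EuclideanSpace.equiv (Fin (lyndonDim q k)) ℝ).symm.toContinuousLinearMap.comp
    (ContinuousLinearMap.pi fun i => ContinuousLinearMap.proj (R := ℝ)
      (φ := fun _ : Word q k => ℝ) ((lyndonIndex q k).symm i).1)

theorem lyndonCoord_apply (a : TruncAlg ℝ q k) (i : Fin (lyndonDim q k)) :
    lyndonCoord q k a i = a ((lyndonIndex q k).symm i).1 := rfl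

theorem exists_lyndonSection (q k : ℕ) :
    ∃ S : EuclideanSpace ℝ (Fin (lyndonDim q k)) → TruncAlg ℝ q k, ContDiff ℝ ∞ S ∧
      (∀ c, S c ∈ realMagnusImage q k) ∧ ∀ c, lyndonCoord q k (S c) = c := by
  obtain ⟨S, h1, h2, h3⟩ := exists_contDiff_lyndon_section (q := q) (k := k)
  refine ⟨fun c => S fun w => c (lyndonIndex q k w), h1.comp ?_,
    fun c => h2 _, fun c => ?_⟩
  · exact contDiff_pi.mpr fun w => by fun_prop
  · ext i
    beta_reduce
    rw [lyndonCoord_apply, h3, Equiv.apply_symm_apply]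

/-- The smooth inverse of the Lyndon coordinates on `realMagnusImage q k`. -/
noncomputable def lyndonSection (q k : ℕ) :
    EuclideanSpace ℝ (Fin (lyndonDim q k)) → TruncAlg ℝ q k :=
  (exists_lyndonSection q k).choose

theorem contDiff_lyndonSection : ContDiff ℝ ∞ (lyndonSection q k) :=
  (exists_lyndonSection q k).choose_spec.1

theorem lyndonSection_mem (c : EuclideanSpace ℝ (Fin (lyndonDim q k))) :
    lyndonSection q k c ∈ realMagnusImage q k :=
  (exists_lyndonSection q k).choose_spec.2.1 c

theorem lyndonCoord_lyndonSection (c : EuclideanSpace ℝ (Fin (lyndonDim q k))) :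
    lyndonCoord q k (lyndonSection q k c) = c :=
  (exists_lyndonSection q k).choose_spec.2.2 c

theorem lyndonSection_lyndonCoord {a : TruncAlg ℝ q k} (ha : a ∈ realMagnusImage q k) :
    lyndonSection q k (lyndonCoord q k a) = a := by
  refine realMagnusImage_ext (lyndonSection_mem _) ha fun w hw => ?_
  have h := congrArg (fun c => c (lyndonIndex q k ⟨w, hw⟩))
    (lyndonCoord_lyndonSection (lyndonCoord q k a))
  simp only [lyndonCoord_apply, Equiv.symm_apply_apply] at h
  exact h

/-- The Lyndon coordinates identify `realMagnusImage q k` with a Euclidean space. -/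
noncomputable def lyndonHomeomorph (q k : ℕ) :
    realMagnusImage q k ≃ₜ EuclideanSpace ℝ (Fin (lyndonDim q k)) where
  toFun a := lyndonCoord q k a.1
  invFun c := ⟨lyndonSection q k c, lyndonSection_mem c⟩
  left_inv a := Subtype.ext (lyndonSection_lyndonCoord a.2)
  right_inv c := lyndonCoord_lyndonSection c
  continuous_toFun := (lyndonCoord q k).continuous.comp continuous_subtype_val
  continuous_invFun := contDiff_lyndonSection.continuous.subtype_mk _

end Coordinates

/-! ### The action of `F / F_k` and the covering map -/

section Action

variable {q k : ℕ}

/-- The action of `F / F_k` by right multiplication, written as a left action by inversion. -/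
noncomputable instance : MulAction (FreeNilpotent q k) (realMagnusImage q k) where
  smul g a := ⟨a.1 * magnusBar ℝ q k g⁻¹,
    mul_mem_realMagnusImage a.2 (magnusBar_mem_realMagnusImage _)⟩
  one_smul a := Subtype.ext (by
    change a.1 * (magnusBar ℝ q k 1⁻¹ : TruncAlg ℝ q k) = a.1
    rw [inv_one, map_one, Units.val_one, mul_one])
  mul_smul g h a := Subtype.ext (by
    change a.1 * (magnusBar ℝ q k (g * h)⁻¹ : TruncAlg ℝ q k) =
      a.1 * magnusBar ℝ q k h⁻¹ * magnusBar ℝ q k g⁻¹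
    rw [mul_inv_rev, map_mul, Units.val_mul, mul_assoc])

theorem orbitRel_realMagnusImage :
    MulAction.orbitRel (FreeNilpotent q k) (realMagnusImage q k) = magnusSetoid q k := by
  ext a b
  rw [MulAction.orbitRel_apply]
  constructor
  · rintro ⟨g, rfl⟩
    refine ⟨g, ?_⟩
    change b.1 = b.1 * (magnusBar ℝ q k g⁻¹ : TruncAlg ℝ q k) * magnusBar ℝ q k g
    rw [mul_assoc, ← Units.val_mul, ← map_mul, inv_mul_cancel, map_one, Units.val_one, mul_one]
  · rintro ⟨g, hg⟩
    refine ⟨g, Subtype.ext ?_⟩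
    change b.1 * (magnusBar ℝ q k g⁻¹ : TruncAlg ℝ q k) = a.1
    rw [hg, mul_assoc, ← Units.val_mul, ← map_mul, mul_inv_cancel, map_one, Units.val_one, mul_one]

theorem unipotentPow_neg_one_mul_of_mem {a : TruncAlg ℝ q k} (ha : a ∈ realMagnusImage q k) :
    unipotentPow a (-1) * a = 1 :=
  unipotentPow_neg_one_mul (orderGE_sub_one_iff.mpr ha.1)

theorem eq_one_of_mul_magnusBar_eq (hk : 1 ≤ k) {g : FreeNilpotent q k} {a : TruncAlg ℝ q k}
    (ha : a ∈ realMagnusImage q k) (h : a * magnusBar ℝ q k g = a) : g = 1 := by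
  have h1 := congrArg (unipotentPow a (-1) * ·) h
  simp only [← mul_assoc, unipotentPow_neg_one_mul_of_mem ha, one_mul] at h1
  refine magnusBar_injective hk (Units.ext ?_)
  rw [h1, map_one, Units.val_one]

theorem TruncAlg.continuous_pow {E : Type*} [TopologicalSpace E] {f : E → TruncAlg ℝ q k}
    (hf : Continuous f) (n : ℕ) : Continuous fun x => f x ^ n := by
  induction n with
  | zero => simp only [pow_zero]; exact continuous_const
  | succ n ih =>
    simp only [pow_succ]
    exact TruncAlg.continuous_mul ih hf

theorem continuous_unipotentPow_left (t : ℝ) :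
    Continuous fun u : TruncAlg ℝ q k => unipotentPow u t := by
  unfold unipotentPow
  refine continuous_finsetSum _ fun j _ => ?_
  have h : Continuous fun u : TruncAlg ℝ q k => (u - 1) ^ j :=
    TruncAlg.continuous_pow (continuous_id.sub continuous_const) j
  exact h.const_smul ((descPochhammer ℝ j).eval t / (j.factorial : ℝ))

/-- An element of the real algebra all of whose coefficients are integers. -/
def TruncAlg.IsIntegral (f : TruncAlg ℝ q k) : Prop := ∀ w, ∃ z : ℤ, f w = z

theorem TruncAlg.IsIntegral.mul {f g : TruncAlg ℝ q k} (hf : f.IsIntegral) (hg : g.IsIntegral) :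
    (f * g).IsIntegral := by
  intro w
  choose zf hf using hf
  choose zg hg using hg
  refine ⟨∑ i ∈ Finset.range (w.1.length + 1), zf (w.take i) * zg (w.drop i), ?_⟩
  simp only [mul_apply, hf, hg]
  push_cast
  rfl

theorem TruncAlg.IsIntegral.sub {f g : TruncAlg ℝ q k} (hf : f.IsIntegral) (hg : g.IsIntegral) :
    (f - g).IsIntegral := by
  intro w
  obtain ⟨a, ha⟩ := hf w
  obtain ⟨b, hb⟩ := hg w
  exact ⟨a - b, by rw [TruncAlg.sub_apply, ha, hb]; push_cast; rfl⟩

theorem TruncAlg.isIntegral_zero : (0 : TruncAlg ℝ q k).IsIntegral := fun _ =>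
  ⟨0, by rw [TruncAlg.zero_apply, Int.cast_zero]⟩

theorem TruncAlg.isIntegral_one : (1 : TruncAlg ℝ q k).IsIntegral := fun w =>
  ⟨if w.1 = [] then 1 else 0, by rw [one_apply]; split_ifs <;> simp⟩

theorem TruncAlg.isIntegral_X (i : Fin q) : (X i : TruncAlg ℝ q k).IsIntegral := fun w =>
  ⟨if w.1 = [i] then 1 else 0, by rw [X]; split_ifs <;> simp⟩

theorem isIntegral_magnus (x : FreeGroup (Fin q)) :
    (magnus ℝ q k x : TruncAlg ℝ q k).IsIntegral := by
  have hneg {f : TruncAlg ℝ q k} (hf : f.IsIntegral) : (-f).IsIntegral := by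
    rw [← zero_sub]; exact isIntegral_zero.sub hf
  induction x using FreeGroup.induction_on with
  | C1 => rw [map_one, Units.val_one]; exact isIntegral_one
  | of i =>
    have h : (magnus ℝ q k (FreeGroup.of i) : TruncAlg ℝ q k) = 1 - -X i := by
      simp [magnus, oneAddX]
    rw [h]
    exact isIntegral_one.sub (hneg (isIntegral_X i))
  | inv_of i _ =>
    have h : (magnus ℝ q k (FreeGroup.of i)⁻¹ : TruncAlg ℝ q k) =
        ∑ j ∈ Finset.range k, (-X i) ^ j := by
      rw [map_inv, magnus, FreeGroup.lift_apply_of]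
      rfl
    change (magnus ℝ q k (FreeGroup.of i)⁻¹ : TruncAlg ℝ q k).IsIntegral
    rw [h]
    have hpow (j : ℕ) : ((-X i : TruncAlg ℝ q k) ^ j).IsIntegral := by
      induction j with
      | zero => rw [pow_zero]; exact isIntegral_one
      | succ j ih => rw [pow_succ]; exact ih.mul (hneg (isIntegral_X i))
    refine Finset.sum_induction _ TruncAlg.IsIntegral (fun f g hf hg => ?_) isIntegral_zero
      fun j _ => hpow j
    rw [← sub_neg_eq_add]
    exact hf.sub (hneg hg)
  | mul x y hx hy => rw [map_mul, Units.val_mul]; exact hx.mul hy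

/-- A compact set contains only finitely many integral elements. -/
theorem TruncAlg.finite_isIntegral {C : Set (TruncAlg ℝ q k)} (hC : IsCompact C) :
    {f ∈ C | f.IsIntegral}.Finite := by
  obtain ⟨R, hR⟩ := isBounded_iff_forall_norm_le.mp hC.isBounded
  let c : (Word q k → ℤ) → TruncAlg ℝ q k := fun z w => z w
  refine ((Set.Finite.pi' fun _ : Word q k => Set.finite_Icc (-⌈R⌉) ⌈R⌉).image c).subset ?_
  rintro f ⟨hf, hz⟩
  choose z hz using hz
  refine ⟨z, fun w => ?_, TruncAlg.ext fun w => (hz w).symm⟩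
  have h1 : |f w| ≤ ‖f‖ := norm_le_pi_norm (G := fun _ : Word q k => ℝ) f w
  have h2 := abs_le.mp ((h1.trans (hR f hf)).trans (Int.le_ceil R))
  rw [hz] at h2
  exact ⟨by exact_mod_cast h2.1, by exact_mod_cast h2.2⟩

theorem finite_magnusBar_mem (hk : 1 ≤ k) {C : Set (TruncAlg ℝ q k)} (hC : IsCompact C) :
    {g : FreeNilpotent q k | (magnusBar ℝ q k g : TruncAlg ℝ q k) ∈ C}.Finite := by
  have hinj : Function.Injective fun g : FreeNilpotent q k =>
      (magnusBar ℝ q k g : TruncAlg ℝ q k) :=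
    Units.val_injective.comp (magnusBar_injective hk)
  refine ((TruncAlg.finite_isIntegral hC).preimage hinj.injOn).subset fun g hg => ⟨hg, ?_⟩
  induction g using QuotientGroup.induction_on with
  | H x => exact isIntegral_magnus x

instance : ContinuousConstSMul (FreeNilpotent q k) (realMagnusImage q k) where
  continuous_const_smul _ :=
    (TruncAlg.continuous_mul continuous_subtype_val continuous_const).subtype_mk _

/-- The values of the Magnus expansion have integer coefficients, so only finitely many of them
are of the form `a⁻¹ b` with `a` and `b` in given compact sets. -/
theorem properlyDiscontinuousSMul_realMagnusImage (hk : 1 ≤ k) :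
    ProperlyDiscontinuousSMul (FreeNilpotent q k) (realMagnusImage q k) where
  finite_disjoint_inter_image {K L} hK hL := by
    have hC : IsCompact ((fun p : realMagnusImage q k × realMagnusImage q k =>
        unipotentPow p.1.1 (-1) * p.2.1) '' K ×ˢ L) :=
      (hK.prod hL).image (TruncAlg.continuous_mul
        ((continuous_unipotentPow_left _).comp (continuous_subtype_val.comp continuous_fst))
        (continuous_subtype_val.comp continuous_snd))
    refine ((finite_magnusBar_mem hk hC).preimage inv_injective.injOn).subset ?_
    rintro g ⟨_, ⟨a, ha, rfl⟩, hb⟩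
    refine ⟨(a, g • a), ⟨ha, hb⟩, ?_⟩
    change unipotentPow a.1 (-1) * (a.1 * _) = _
    rw [← mul_assoc, unipotentPow_neg_one_mul_of_mem a.2, one_mul]

instance : LocallyCompactSpace (realMagnusImage q k) :=
  (lyndonHomeomorph q k).isClosedEmbedding.locallyCompactSpace

instance : SecondCountableTopology (realMagnusImage q k) :=
  (lyndonHomeomorph q k).secondCountableTopology

instance : ContractibleSpace (realMagnusImage q k) :=
  (lyndonHomeomorph q k).contractibleSpace

theorem isQuotientCoveringMap_magnusQuotient (hk : 1 ≤ k) :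
    IsQuotientCoveringMap (Quotient.mk (magnusSetoid q k)) (FreeNilpotent q k) := by
  have := properlyDiscontinuousSMul_realMagnusImage (q := q) hk
  have : IsCancelSMul (FreeNilpotent q k) (realMagnusImage q k) := by
    refine isCancelSMul_iff_eq_one_of_smul_eq.mpr fun g a h => ?_
    have h1 := congrArg Subtype.val h
    exact inv_eq_one.mp (eq_one_of_mul_magnusBar_eq hk a.2 h1)
  rw [← orbitRel_realMagnusImage]
  exact isQuotientCoveringMap_quotientMk_of_properlyDiscontinuousSMul

theorem t2Space_magnusQuotient (hk : 1 ≤ k) : T2Space (MagnusQuotient q k) := by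
  have := properlyDiscontinuousSMul_realMagnusImage (q := q) hk
  change T2Space (Quotient (magnusSetoid q k))
  rw [← orbitRel_realMagnusImage]
  infer_instance

theorem secondCountableTopology_magnusQuotient : SecondCountableTopology (MagnusQuotient q k) := by
  change SecondCountableTopology (Quotient (magnusSetoid q k))
  rw [← orbitRel_realMagnusImage]
  exact ContinuousConstSMul.secondCountableTopology

/-- The quotient is the image of the unit cube in Lyndon coordinates. -/
theorem compactSpace_magnusQuotient : CompactSpace (MagnusQuotient q k) := by
  let K : Set (EuclideanSpace ℝ (Fin (lyndonDim q k))) :=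
    (EuclideanSpace.equiv (Fin (lyndonDim q k)) ℝ).toHomeomorph ⁻¹' Set.Icc 0 1
  have hK : IsCompact K :=
    ((EuclideanSpace.equiv (Fin (lyndonDim q k)) ℝ).toHomeomorph.isCompact_preimage).mpr
      isCompact_Icc
  have hc : Continuous fun c => (Quotient.mk (magnusSetoid q k) ((lyndonHomeomorph q k).symm c)) :=
    continuous_quotient_mk'.comp (lyndonHomeomorph q k).symm.continuous
  refine ⟨?_⟩
  convert hK.image hc
  refine (Set.eq_univ_of_forall fun y => ?_).symm
  induction y using Quotient.inductionOn with | h a => ?_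
  obtain ⟨x, hx⟩ := exists_magnus_mul_mem_Icc a.2
  let b : realMagnusImage q k :=
    ⟨a.1 * magnus ℝ q k x, mul_mem_realMagnusImage a.2 (magnus_mem_realMagnusImage x)⟩
  refine ⟨lyndonHomeomorph q k b, ⟨fun i => (hx _).1, fun i => (hx _).2⟩, ?_⟩
  change Quotient.mk _ ((lyndonHomeomorph q k).symm (lyndonHomeomorph q k b)) = _
  rw [Homeomorph.symm_apply_apply]
  exact (Quotient.sound (show (magnusSetoid q k).r a b from ⟨(x : FreeNilpotent q k), rfl⟩)).symm

theorem pathConnectedSpace_magnusQuotient : PathConnectedSpace (MagnusQuotient q k) :=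
  Quotient.mk_surjective.pathConnectedSpace continuous_quotient_mk'

end Action

/-! ### The smooth structure of the quotient -/

section LocalHomeomorph

variable {X Y E : Type*} [TopologicalSpace X] [TopologicalSpace Y] [NormedAddCommGroup E]
  {p : X → Y}

/-- The smooth structure transported along a homeomorphism with a vector space. -/
@[reducible] def Homeomorph.globalChartedSpace (φ : X ≃ₜ E) : ChartedSpace E X :=
  φ.toOpenPartialHomeomorph.singletonChartedSpace rfl

/-- A local inverse of `p` near `p x`, followed by the global chart `φ`. -/
noncomputable def IsLocalHomeomorph.chart (hp : IsLocalHomeomorph p) (φ : X ≃ₜ E) (x : X) :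
    OpenPartialHomeomorph Y E :=
  (hp x).choose.symm.trans φ.toOpenPartialHomeomorph

/-- The charts of the target of a local homeomorphism `p` whose source has the global
chart `φ`. -/
@[reducible] noncomputable def IsLocalHomeomorph.pushChartedSpace (hp : IsLocalHomeomorph p)
    (hs : Function.Surjective p) (φ : X ≃ₜ E) : ChartedSpace E Y where
  atlas := Set.range (hp.chart φ)
  chartAt y := hp.chart φ (Function.surjInv hs y)
  mem_chart_source y := by
    obtain ⟨h1, h2⟩ := (hp (Function.surjInv hs y)).choose_spec
    have h3 := (hp (Function.surjInv hs y)).choose.map_source h1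
    rw [← h2, Function.surjInv_eq hs] at h3
    simpa [IsLocalHomeomorph.chart] using h3
  chart_mem_atlas y := ⟨_, rfl⟩

variable [NormedSpace ℝ E]

theorem Homeomorph.isManifold (φ : X ≃ₜ E) :
    letI := φ.globalChartedSpace
    IsManifold 𝓘(ℝ, E) ∞ X :=
  φ.toOpenPartialHomeomorph.isManifold_singleton _

/-- If any two points of a fibre of `p` are related by a smooth map which is compatible with `p`,
then the charts of the target are smoothly compatible. -/
theorem IsLocalHomeomorph.isManifold (hp : IsLocalHomeomorph p) (hs : Function.Surjective p)
    (φ : X ≃ₜ E)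
    (hT : ∀ x x', p x = p x' → ∃ T : E → E, ContDiff ℝ ∞ T ∧ T (φ x) = φ x' ∧
      ∀ e, p (φ.symm (T e)) = p (φ.symm e)) :
    letI := hp.pushChartedSpace hs φ
    IsManifold 𝓘(ℝ, E) ∞ Y := by
  let := hp.pushChartedSpace hs φ
  refine isManifold_of_contDiffOn _ _ _ ?_
  rintro _ _ ⟨a, rfl⟩ ⟨b, rfl⟩
  obtain ⟨-, ha⟩ := (hp a).choose_spec
  obtain ⟨-, hb⟩ := (hp b).choose_spec
  simp only [IsLocalHomeomorph.chart]
  set ea := (hp a).choose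
  set eb := (hp b).choose
  intro c hc
  have hc1 : φ.symm c ∈ ea.source ∧ ea (φ.symm c) ∈ eb.target := by simpa using hc
  obtain ⟨hc1, hc2⟩ := hc1
  rw [← ha] at hc2
  obtain ⟨T, hT1, hT2, hT3⟩ := hT (φ.symm c) (eb.symm (p (φ.symm c)))
    (by rw [hb, eb.right_inv]; rwa [hb] at hc2)
  rw [Homeomorph.apply_symm_apply] at hT2
  -- near `c`, the change of charts is the map `T`
  refine ContDiffAt.contDiffWithinAt ((hT1.contDiffAt).congr_of_eventuallyEq ?_)
  have h1 : ∀ᶠ c' in 𝓝 c, φ.symm (T c') ∈ eb.source := by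
    have hcont : Continuous fun c' => φ.symm (T c') := φ.symm.continuous.comp hT1.continuous
    refine hcont.continuousAt.eventually_mem (eb.open_source.mem_nhds ?_)
    rw [hT2, Homeomorph.symm_apply_apply]
    exact eb.map_target hc2
  filter_upwards [h1] with c' hc'
  have h2 : eb.symm (ea (φ.symm c')) = φ.symm (T c') := by
    rw [← ha, ← hT3, hb, eb.left_inv hc']
  simp [h2]

/-- In the chart `φ` of the source and the chart `hp.chart φ x` of the target, the map `p` is the
identity near `x`. -/
theorem IsLocalHomeomorph.isLocalDiffeomorph (hp : IsLocalHomeomorph p)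
    (hs : Function.Surjective p) (φ : X ≃ₜ E)
    (hY : letI := hp.pushChartedSpace hs φ; IsManifold 𝓘(ℝ, E) ∞ Y) :
    letI := φ.globalChartedSpace
    letI := hp.pushChartedSpace hs φ
    IsLocalDiffeomorph 𝓘(ℝ, E) 𝓘(ℝ, E) ∞ p := by
  let := φ.globalChartedSpace
  let := hp.pushChartedSpace hs φ
  have := φ.isManifold
  intro x
  obtain ⟨hx, he⟩ := (hp x).choose_spec
  have hψ : hp.chart φ x ∈ IsManifold.maximalAtlas 𝓘(ℝ, E) ∞ Y :=
    IsManifold.subset_maximalAtlas ⟨x, rfl⟩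
  have hφ : φ.toOpenPartialHomeomorph ∈ IsManifold.maximalAtlas 𝓘(ℝ, E) ∞ X :=
    IsManifold.subset_maximalAtlas rfl
  simp only [IsLocalHomeomorph.chart] at hψ
  set e := (hp x).choose
  have hsource : e.target ⊆ (e.symm.trans φ.toOpenPartialHomeomorph).source := by simp
  refine ⟨⟨e.toPartialEquiv, e.open_source, e.open_target, ?_, ?_⟩, hx, fun y _ => congrFun he y⟩
  · refine (contMDiffOn_iff_of_mem_maximalAtlas hφ hψ (Set.subset_univ _)
      fun y hy => hsource (e.map_source hy)).mpr ⟨e.continuousOn, ?_⟩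
    refine contDiffOn_id.congr ?_
    rintro _ ⟨y, hy, rfl⟩
    simp [e.left_inv hy]
  · refine (contMDiffOn_iff_of_mem_maximalAtlas hψ hφ hsource
      (Set.mapsTo_univ _ _)).mpr ⟨e.symm.continuousOn, ?_⟩
    refine contDiffOn_id.congr ?_
    rintro _ ⟨y, hy, rfl⟩
    simp [e.right_inv hy]

end LocalHomeomorph

section Embedding

variable {E A : Type*} [NormedAddCommGroup E] [NormedSpace ℝ E] [FiniteDimensional ℝ E]
  [NormedAddCommGroup A] [NormedSpace ℝ A]

/-- A subset of `A` which is the graph of a smooth map over a coordinate subspace is a smooth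
submanifold: the shear `a ↦ a - S (P a) + σ (P a)`, with `σ` a linear right inverse of `P`, is a
global chart of `A` in which the subset is a linear subspace. -/
theorem isSmoothEmbedding_subtypeVal {M : Set A} (φ : M ≃ₜ E) (P : A →L[ℝ] E)
    (hP : ∀ a : M, P a.1 = φ a) (hS : ContDiff ℝ ∞ fun e => (φ.symm e).1) :
    letI := φ.globalChartedSpace
    Manifold.IsSmoothEmbedding 𝓘(ℝ, E) 𝓘(ℝ, A) ∞ (Subtype.val : M → A) := by
  let := φ.globalChartedSpace
  have := φ.isManifold
  have hPS (e : E) : P (φ.symm e).1 = e := by rw [hP, Homeomorph.apply_symm_apply]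
  obtain ⟨σ', hσ'⟩ := (P : A →ₗ[ℝ] E).exists_rightInverse_of_surjective
    (LinearMap.range_eq_top.mpr fun e => ⟨_, hPS e⟩)
  let σ : E →L[ℝ] A := LinearMap.toContinuousLinearMap σ'
  have hσ (e : E) : P (σ e) = e := LinearMap.congr_fun hσ' e
  let Θ : A ≃ₜ A :=
    { toFun := fun a => a - (φ.symm (P a)).1 + σ (P a)
      invFun := fun a => a - σ (P a) + (φ.symm (P a)).1
      left_inv := fun a => by simp [hσ, hPS]
      right_inv := fun a => by simp [hσ, hPS]
      continuous_toFun := (continuous_id.sub (hS.continuous.comp P.continuous)).add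
        (σ.continuous.comp P.continuous)
      continuous_invFun := (continuous_id.sub (σ.continuous.comp P.continuous)).add
        (hS.continuous.comp P.continuous) }
  have hΘ : Θ.toOpenPartialHomeomorph ∈ IsManifold.maximalAtlas 𝓘(ℝ, A) ∞ A := by
    refine StructureGroupoid.mem_maximalAtlas_of_mem_groupoid _ ?_
    have h1 : ContDiff ℝ ∞ Θ :=
      (contDiff_id.sub (hS.comp P.contDiff)).add (σ.contDiff.comp P.contDiff)
    have h2 : ContDiff ℝ ∞ Θ.symm :=
      (contDiff_id.sub (σ.contDiff.comp P.contDiff)).add (hS.comp P.contDiff)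
    exact ⟨h1.contDiffOn, h2.contDiffOn⟩
  have hφ : φ.toOpenPartialHomeomorph ∈ IsManifold.maximalAtlas 𝓘(ℝ, E) ∞ M :=
    IsManifold.subset_maximalAtlas rfl
  refine ⟨Manifold.IsImmersionOfComplement.isImmersion (F := P.ker) fun x => ?_,
    Topology.IsEmbedding.subtypeVal⟩
  refine Manifold.IsImmersionAtOfComplement.mk_of_charts
    (ContinuousLinearEquiv.equivOfRightInverse P σ hσ).symm φ.toOpenPartialHomeomorph
    Θ.toOpenPartialHomeomorph (Set.mem_univ _) (Set.mem_univ _) hφ hΘ (Set.subset_univ _) ?_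
  intro e _
  change (φ.symm e).1 - (φ.symm (P (φ.symm e).1)).1 + σ (P (φ.symm e).1) = _
  rw [hPS, sub_self, zero_add]
  simp

end Embedding

/-! ### Higher homotopy groups of a space covered by a vector space -/

section Homotopy

theorem locallyPathConnectedSpace_unitInterval : LocallyPathConnectedSpace unitInterval :=
  (isQuotientMap_projIcc (h := zero_le_one)).locallyPathConnectedSpace

theorem contractibleSpace_cube (ι : Type*) : ContractibleSpace (ι → unitInterval) :=
  (contractible_iff_id_nullhomotopic _).mpr ⟨0, ⟨
    { toFun := fun x i => unitInterval.symm x.1 * x.2 i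
      continuous_toFun := by fun_prop
      map_zero_left := fun z => by ext; simp
      map_one_left := fun z => by ext; simp }⟩⟩

/-- A lift of an `n`-dimensional loop, `n ≥ 2`, through a covering map is an `n`-dimensional loop:
the lift is constant on each face of the cube, and any face meets one of the faces through
the origin. -/
theorem IsCoveringMap.lift_mem_genLoop {X Y : Type*} [TopologicalSpace X] [TopologicalSpace Y]
    {p : X → Y} (hp : IsCoveringMap p) {n : ℕ} (hn : 2 ≤ n) {y : Y} (f : GenLoop (Fin n) Y y)
    {F : C(Fin n → unitInterval, X)} (hF : p ∘ F = f) : F ∈ GenLoop (Fin n) X (F 0) := by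
  have hF' (z : Fin n → unitInterval) : p (F z) = f z := congrFun hF z
  have hface (i : Fin n) (ε : unitInterval) (hε : ε = 0 ∨ ε = 1) (z z' : Fin n → unitInterval) :
      F (Function.update z i ε) = F (Function.update z' i ε) := by
    refine hp.const_of_comp (g := fun z => F (Function.update z i ε))
      (F.continuous.comp (continuous_id.update i continuous_const)) (fun z z' => ?_) z z'
    rw [hF', hF', GenLoop.boundary f _ ⟨i, by simpa using hε⟩,
      GenLoop.boundary f _ ⟨i, by simpa using hε⟩]
  rintro z ⟨i, hi⟩
  have : Nontrivial (Fin n) := Fin.nontrivial_iff_two_le.mpr hn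
  obtain ⟨j, hj⟩ := exists_ne i
  have h1 := hface i (z i) hi z 0
  have h2 := hface j 0 (.inl rfl) (Function.update 0 i (z i)) 0
  rw [Function.update_eq_self] at h1
  have h3 : Function.update (Function.update (0 : Fin n → unitInterval) i (z i)) j 0 =
      Function.update (0 : Fin n → unitInterval) i (z i) :=
    Function.update_eq_self_iff.mpr (by rw [Function.update_of_ne hj]; rfl)
  have h4 : Function.update (0 : Fin n → unitInterval) j 0 = 0 :=
    Function.update_eq_self_iff.mpr rfl
  rw [h3, h4] at h2
  rw [h1, h2]

/-- In a vector space, two maps which agree on a subset are homotopic relative to it. -/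
theorem ContinuousMap.homotopicRel_of_eqOn {A E : Type*} [TopologicalSpace A]
    [NormedAddCommGroup E] [NormedSpace ℝ E] {f g : C(A, E)} {S : Set A} (h : Set.EqOn f g S) :
    f.HomotopicRel g S :=
  ⟨{ ContinuousMap.Homotopy.affine f g with
      prop' := fun t z hz => by
        change AffineMap.lineMap (f z) (g z) (t : ℝ) = f z
        rw [h hz, AffineMap.lineMap_same_apply] }⟩

/-- A loop of dimension at least `2` lifts to a loop in `X`, which contracts along straight lines
in the coordinates `φ`. -/
theorem IsCoveringMap.subsingleton_homotopyGroup {X Y E : Type*} [TopologicalSpace X]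
    [TopologicalSpace Y] [NormedAddCommGroup E] [NormedSpace ℝ E] {p : X → Y}
    (hp : IsCoveringMap p) (hs : Function.Surjective p) (φ : X ≃ₜ E) {n : ℕ} (hn : 2 ≤ n) (y : Y) :
    Subsingleton (π_ n Y y) := by
  have := locallyPathConnectedSpace_unitInterval
  have := contractibleSpace_cube (Fin n)
  suffices h : ∀ f : GenLoop (Fin n) Y y, GenLoop.Homotopic f GenLoop.const by
    refine ⟨fun a b => ?_⟩
    induction a using Quotient.inductionOn with | h f => ?_
    induction b using Quotient.inductionOn with | h g => ?_
    exact Quotient.sound ((h f).trans (h g).symm)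
  intro f
  obtain ⟨x, hx⟩ := hs (f 0)
  obtain ⟨F, ⟨-, hF⟩, -⟩ := hp.existsUnique_continuousMap_lifts f.1 0 x hx
  have hF2 := hp.lift_mem_genLoop hn f hF
  have h1 : ((φ : C(X, E)).comp F).HomotopicRel ((φ : C(X, E)).comp (.const _ (F 0)))
      (Cube.boundary (Fin n)) :=
    ContinuousMap.homotopicRel_of_eqOn fun z hz => congrArg φ (hF2 z hz)
  have h2 := h1.comp_continuousMap
    ((⟨p, hp.continuous⟩ : C(X, Y)).comp (φ.symm : C(E, X)))
  have h0 : (0 : Fin n → unitInterval) ∈ Cube.boundary (Fin n) := ⟨⟨0, by omega⟩, .inl rfl⟩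
  rw [GenLoop.Homotopic]
  convert h2 using 1
  · ext z
    simpa using (congrFun hF z).symm
  · ext z
    simpa using ((GenLoop.boundary f 0 h0).symm.trans (congrFun hF 0).symm)

end Homotopy

/-! ### The quotient as a manifold and as an Eilenberg–MacLane space -/

/-- Two points of an orbit are related by right multiplication with a value of the Magnus
expansion, which is smooth in the Lyndon coordinates. -/
theorem exists_contDiff_deck_transformation {q k : ℕ} (a b : realMagnusImage q k)
    (h : Quotient.mk (magnusSetoid q k) a = Quotient.mk (magnusSetoid q k) b) :
    ∃ T : EuclideanSpace ℝ (Fin (lyndonDim q k)) → EuclideanSpace ℝ (Fin (lyndonDim q k)),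
      ContDiff ℝ ∞ T ∧ T (lyndonHomeomorph q k a) = lyndonHomeomorph q k b ∧
      ∀ e, Quotient.mk (magnusSetoid q k) ((lyndonHomeomorph q k).symm (T e)) =
        Quotient.mk (magnusSetoid q k) ((lyndonHomeomorph q k).symm e) := by
  obtain ⟨g, hg⟩ := Quotient.exact h
  refine ⟨fun e => lyndonCoord q k (lyndonSection q k e * magnusBar ℝ q k g),
    (lyndonCoord q k).contDiff.comp (contDiff_mul contDiff_lyndonSection contDiff_const), ?_,
    fun e => Quotient.sound ((magnusSetoid q k).symm ?_)⟩
  · change lyndonCoord q k (lyndonSection q k (lyndonCoord q k a.1) * _) = lyndonCoord q k b.1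
    rw [lyndonSection_lyndonCoord a.2, hg]
  · exact ⟨g, lyndonSection_lyndonCoord
      (mul_mem_realMagnusImage (lyndonSection_mem e) (magnusBar_mem_realMagnusImage g))⟩

theorem isEilenbergMacLaneOne_magnusQuotient {q k : ℕ} (hk : 1 ≤ k) :
    IsEilenbergMacLaneOne (MagnusQuotient q k) (FreeNilpotent q k) := by
  have hp := isQuotientCoveringMap_magnusQuotient (q := q) hk
  refine ⟨pathConnectedSpace_magnusQuotient, fun y => ?_, fun n hn y =>
    hp.isCoveringMap.subsingleton_homotopyGroup hp.surjective (lyndonHomeomorph q k) hn y⟩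
  obtain ⟨a, ha⟩ := hp.surjective y
  exact ⟨(hp.fundamentalGroupEquiv ⟨a, ha⟩).trans (MulEquiv.inv' (FreeNilpotent q k)).symm⟩

theorem theoremA1 (q k : ℕ) (hk : 1 ≤ k) :
    -- `F / F_k` acts freely on the subset cut out by the shuffle relations
    (∀ (g : FreeNilpotent q k), ∀ a ∈ realMagnusImage q k,
      a * magnusBar ℝ q k g ∈ realMagnusImage q k) ∧
    (∀ (g : FreeNilpotent q k), ∀ a ∈ realMagnusImage q k,
      a * magnusBar ℝ q k g = a → g = 1) ∧
    -- the quotient is a closed connected smooth manifold, with the smooth structure for which the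
    -- projection from the smooth submanifold `realMagnusImage q k` is a local diffeomorphism
    (∃ (n : ℕ) (_ : ChartedSpace (EuclideanSpace ℝ (Fin n)) (realMagnusImage q k))
      (_ : ChartedSpace (EuclideanSpace ℝ (Fin n)) (MagnusQuotient q k)),
      IsManifold (𝓡 n) ∞ (realMagnusImage q k) ∧
      Manifold.IsSmoothEmbedding (𝓡 n) 𝓘(ℝ, TruncAlg ℝ q k) ∞
        (Subtype.val : realMagnusImage q k → TruncAlg ℝ q k) ∧
      IsManifold (𝓡 n) ∞ (MagnusQuotient q k) ∧
      IsLocalDiffeomorph (𝓡 n) (𝓡 n) ∞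
        (Quotient.mk (magnusSetoid q k) : realMagnusImage q k → MagnusQuotient q k)) ∧
    T2Space (MagnusQuotient q k) ∧
    SecondCountableTopology (MagnusQuotient q k) ∧
    CompactSpace (MagnusQuotient q k) ∧
    ConnectedSpace (MagnusQuotient q k) ∧
    -- the quotient is an Eilenberg–MacLane space `K(F / F_k, 1)`
    IsEilenbergMacLaneOne (MagnusQuotient q k) (FreeNilpotent q k) := by
  have hp := isQuotientCoveringMap_magnusQuotient (q := q) hk
  have hloc := hp.isCoveringMap.isLocalHomeomorph
  have hM := hloc.isManifold hp.surjective (lyndonHomeomorph q k)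
    exists_contDiff_deck_transformation
  have := pathConnectedSpace_magnusQuotient (q := q) (k := k)
  refine ⟨fun g a ha => mul_mem_realMagnusImage ha (magnusBar_mem_realMagnusImage g),
    fun g a ha h => eq_one_of_mul_magnusBar_eq hk ha h,
    ⟨lyndonDim q k, (lyndonHomeomorph q k).globalChartedSpace,
      hloc.pushChartedSpace hp.surjective (lyndonHomeomorph q k),
      (lyndonHomeomorph q k).isManifold,
      isSmoothEmbedding_subtypeVal (lyndonHomeomorph q k) (lyndonCoord q k) (fun _ => rfl)
        contDiff_lyndonSection,
      hM, hloc.isLocalDiffeomorph hp.surjective (lyndonHomeomorph q k) hM⟩,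
    t2Space_magnusQuotient hk, secondCountableTopology_magnusQuotient,
    compactSpace_magnusQuotient, inferInstance, isEilenbergMacLaneOne_magnusQuotient hk⟩
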